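/- Let $r\ge 1$. For $s_1,\dots,s_r\in\mathbb C\setminus\mathbb Z$ put $$\zeta^{\mathrm{des}}_r(s_1,\dots,s_r)=\lim_{c\to1,\;c\in\mathbb R\setminus\{1\}}\frac{1}{(1-c)^r}\prod_{k=1}^r\frac{1}{(e^{2\pi i s_k}-1)\Gamma(s_k)}\int_{\mathcal C^r}\prod_{j=1}^r\Bigl(\frac{1}{e^{t_j+\cdots+t_r}-1}-\frac{c}{e^{c(t_j+\cdots+t_r)}-1}\Bigr)\prod_{k=1}^r t_k^{s_k-1}\,dt_k ,$$ where the removable singularity of $\frac1{e^y-1}-\frac c{e^{cy}-1}$ at $y=0$ is filled in, and $\mathcal C$ is the Hankel contour: from $+\infty$ along the top side of the positive real axis ($\arg t=0$), counterclockwise once around the circle $|t|=\varepsilon$ with $\varepsilon>0$ sufficiently small, and back to $+\infty$ along the bottom side ($\arg t=2\pi$). These integrals converge absolutely for $c\neq 1$ close to $1$, the limit exists and does not depend on small $\varepsilon$, and $\zeta^{\mathrm{des}}_r$ extends to an entire function on $\mathbb C^r$ (the desingularized multiple zeta function), denoted by the same symbol. For $t\in(0,1)$ put $J[f](t)=\int_0^t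 f(z)\,\frac{dz}{z}$, $J^{-1}[f](t)=D[f](t)=t f'(t)$, $$L_0(t)=\frac{t}{1-t}+\frac{t\log t}{(1-t)^2},$$ and, for $\mathbf k=(k_1,\dots,k_r)\in\mathbb Z^r$, $$L^{\mathrm{des}}(\mathbf k)(t)=J^{k_r}\Bigl[L_0\,J^{k_{r-1}}\bigl[L_0\cdots J^{k_1}[L_0]\cdots\bigr]\Bigr](t).$$ Then for every $\mathbf k=(k_1,\dots,k_r)$ with all $k_j\in\mathbb Z_{\le0}$, $$\lim_{t\to1-0}L^{\mathrm{des}}(\mathbf k)(t)=\zeta^{\mathrm{des}}_r(k_1,\dots,k_r).$$ -/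

import Mathlib

open Filter Topology MeasureTheory

noncomputable section

namespace DesMZF

/-! ### The Hankel contour

The contour comes in from `+∞` along the top side of the positive real axis (argument `0`), runs
once counterclockwise around the circle of radius `ε`, and returns to `+∞` along the bottom side
(argument `2π`). It is parametrized by `u : ℝ`: the parameters `u < 0`, `0 ≤ u ≤ 2π` and `2π < u`
give the three pieces. -/

/-- Modulus of the point of the Hankel contour with parameter `u`. -/
def hankelAbs (ε u : ℝ) : ℝ := ε + max (-u) 0 + max (u - 2 * Real.pi) 0

/-- Argument, in `[0, 2π]`, of the point of the Hankel contour with parameter `u`. -/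
def hankelArg (u : ℝ) : ℝ := max 0 (min u (2 * Real.pi))

/-- The point of the Hankel contour with parameter `u`. -/
def hankel (ε u : ℝ) : ℂ := (hankelAbs ε u : ℂ) * Complex.exp (hankelArg u * Complex.I)

/-- The power `t ^ a` at the point `t` of the Hankel contour with parameter `u`, for the branch of
the logarithm that is continuous along the contour. -/
def hankelPow (ε u : ℝ) (a : ℂ) : ℂ :=
  Complex.exp (a * ((Real.log (hankelAbs ε u) : ℂ) + hankelArg u * Complex.I))

/-! ### The desingularized multiple zeta function -/

/-- The function `1 / (e ^ y - 1) - c / (e ^ (c y) - 1)`, with its removable singularity at `y = 0`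
filled in. -/
def kernel (c : ℝ) (y : ℂ) : ℂ :=
  if y = 0 then ((c : ℂ) - 1) / 2
  else 1 / (Complex.exp y - 1) - c / (Complex.exp (c * y) - 1)

/-- The generating function `∏ⱼ kernel c (tⱼ + ⋯ + tᵣ)`. -/
def genFun (r : ℕ) (c : ℝ) (t : Fin r → ℂ) : ℂ :=
  ∏ j : Fin r, kernel c (∑ k ∈ Finset.Ici j, t k)

/-- The factor `∏ₖ 1 / ((e ^ (2πi sₖ) - 1) Γ(sₖ))`. -/
def coeff (r : ℕ) (s : Fin r → ℂ) : ℂ :=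
  ∏ k : Fin r, 1 / ((Complex.exp (2 * Real.pi * Complex.I * s k) - 1) * Complex.Gamma (s k))

/-- The pullback of `genFun r c t * ∏ₖ tₖ ^ (sₖ - 1) dtₖ` under the parametrization of the
`r`-fold product of the Hankel contour. -/
def integrand (r : ℕ) (s : Fin r → ℂ) (ε c : ℝ) (u : Fin r → ℝ) : ℂ :=
  genFun r c (fun k => hankel ε (u k)) *
    ∏ k : Fin r, (hankelPow ε (u k) (s k - 1) * deriv (hankel ε) (u k))

/-- The expression whose limit as `c → 1` is the desingularized multiple zeta function. -/
def preDesZeta (r : ℕ) (s : Fin r → ℂ) (ε c : ℝ) : ℂ :=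
  1 / (1 - (c : ℂ)) ^ r * (coeff r s * ∫ u : Fin r → ℝ, integrand r s ε c u)

/-- `F` is the desingularized multiple zeta function of depth `r`: it is entire on `ℂ ^ r`, and for
non-integral `s₁, …, sᵣ` its value is the limit as `c → 1`, `c ≠ 1`, of the contour integral
expression, whose integrals converge absolutely, for every sufficiently small radius `ε` of the
circle in the Hankel contour. -/
def IsDesZeta (r : ℕ) (F : (Fin r → ℂ) → ℂ) : Prop :=
  Differentiable ℂ F ∧
    ∀ᶠ ε : ℝ in 𝓝[>] 0, ∀ s : Fin r → ℂ, (∀ (j : Fin r) (n : ℤ), s j ≠ n) →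
      (∀ᶠ c : ℝ in 𝓝[≠] 1, Integrable (integrand r s ε c)) ∧
      Tendsto (fun c : ℝ => preDesZeta r s ε c) (𝓝[≠] 1) (𝓝 (F s))

/-- The defining property determines the function. -/
theorem IsDesZeta.unique {r : ℕ} {F G : (Fin r → ℂ) → ℂ} (hF : IsDesZeta r F)
    (hG : IsDesZeta r G) : F = G := by
  have hd : Dense (Set.pi Set.univ fun _ : Fin r => (Set.range ((↑) : ℤ → ℂ))ᶜ) :=
    dense_pi Set.univ fun _ _ => (Set.countable_range _).dense_compl ℝ
  refine Continuous.ext_on hd hF.1.continuous hG.1.continuous fun s hs => ?_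
  have hs' : ∀ (j : Fin r) (n : ℤ), s j ≠ n := fun j n h => hs j (Set.mem_univ j) ⟨n, h.symm⟩
  obtain ⟨ε, h1, h2⟩ := (hF.2.and hG.2).exists
  exact tendsto_nhds_unique (h1 s hs').2 (h2 s hs').2

open Classical in
/-- The desingularized multiple zeta function of depth `r`, as an entire function on `ℂ ^ r`. -/
def desZeta (r : ℕ) : (Fin r → ℂ) → ℂ :=
  if h : ∃ F, IsDesZeta r F then h.choose else 0

/-! ### The functions defined by iterated integrals and derivatives -/

/-- The operator `J[f](t) = ∫₀ᵗ f(z) dz / z`. -/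
def opJ (f : ℝ → ℝ) (t : ℝ) : ℝ := ∫ z in (0 : ℝ)..t, f z / z

/-- The operator `D[f](t) = t f'(t)`, the inverse of `J`. -/
def opD (f : ℝ → ℝ) (t : ℝ) : ℝ := t * deriv f t

/-- The integral powers of the operator `J`, where `J ^ (-1) = D`. -/
def opJPow : ℤ → (ℝ → ℝ) → ℝ → ℝ
  | Int.ofNat n => opJ^[n]
  | Int.negSucc n => opD^[n + 1]

/-- The function `t / (1 - t) + t log t / (1 - t) ^ 2` on `(0, 1)`. -/
def desLiZero (t : ℝ) : ℝ := t / (1 - t) + t * Real.log t / (1 - t) ^ 2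

/-- The function `J ^ kᵣ [L₀ J ^ kᵣ₋₁ [L₀ ⋯ J ^ k₁ [L₀] ⋯ ]]` on `(0, 1)`, where `L₀` is
`desLiZero`. -/
def desLi : (r : ℕ) → (Fin r → ℤ) → ℝ → ℝ
  | 0, _ => fun _ => 1
  | r + 1, k => opJPow (k (Fin.last r)) fun t => desLiZero t * desLi r (Fin.init k) t

end DesMZF

end

/-! Let `todd z = z / (e ^ z - 1)` and let `desKer` be its derivative. For `y ≠ 0` the kernel is
`(todd y - todd (c * y)) / y`, so after division by `1 - c` it tends to `desKer y`. The mean value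
inequality dominates it uniformly in `c` (`exists_norm_kernel_div_le`), and the limit `c → 1` passes
under the contour integral, leaving the normalized integral of the product of the `desKer (tⱼ + ⋯ +
tᵣ)`.

This limit is made entire by choosing a contour for each variable: the Hankel contour has a
coefficient holomorphic on `Re s < 1`, the half-line with factor `1 / Γ(s)` works on `Re s > 0`, and
Cauchy's theorem shows that they agree on the overlap (`contourEquiv_mix`, `iterInt_congr`). The
glued function `desZetaInt` equals `desZeta` by `IsDesZeta.unique`.

For the values at nonpositive integers a base point `y` is added to every tail sum (`iterInt`).
Integrating over `tᵣ` last gives a recursion in the depth (`iterInt_succ`). At exponent `-n` the two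
straight pieces of the contour cancel, and Cauchy's formula turns the circle into `(-d/dy) ^ n`
(`iterInt_hankel_succ`). Under `y = -log t` the operator `t d/dt` is `-d/dy` and `L₀(t) = desKer y`,
so the recursion is the one that defines `desLi` (`desLi_eq`). The limit `t → 1` is `y → 0`, a point
where `iterInt` is holomorphic. -/

noncomputable section

namespace DesMZF

/-! ### The limit kernel: holomorphy and exponential decay. -/

/-- The entire function `(e ^ z - 1) / z`. -/
def expQuot : ℂ → ℂ := dslope Complex.exp 0

/-- The function `z / (e ^ z - 1)`. -/
def todd (z : ℂ) : ℂ := (expQuot z)⁻¹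

/-- The derivative of `z / (e ^ z - 1)`, which is the limit of `kernel c / (1 - c)` as `c → 1`. -/
def desKer : ℂ → ℂ := deriv todd

/-- The horizontal strip on which `todd` is holomorphic. -/
def strip : Set ℂ := {z | |z.im| < 2 * Real.pi}

theorem isOpen_strip : IsOpen strip :=
  isOpen_lt (by fun_prop) continuous_const

theorem differentiable_expQuot : Differentiable ℂ expQuot := by
  rw [← differentiableOn_univ]
  exact (Complex.differentiableOn_dslope univ_mem).2 Complex.differentiable_exp.differentiableOn

theorem mul_expQuot (z : ℂ) : z * expQuot z = Complex.exp z - 1 := by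
  have := sub_smul_dslope Complex.exp 0 z
  simpa [expQuot] using this

theorem exp_sub_one_ne_zero {z : ℂ} (hz : z ∈ strip) (h0 : z ≠ 0) : Complex.exp z - 1 ≠ 0 := by
  intro h
  rw [sub_eq_zero, Complex.exp_eq_one_iff] at h
  obtain ⟨n, hn⟩ := h
  have him : z.im = n * (2 * Real.pi) := by
    rw [hn]; simp
  have h2 : |z.im| < 2 * Real.pi := hz
  have hn0 : n ≠ 0 := by
    rintro rfl
    exact h0 (by simpa using hn)
  rw [him, abs_mul, abs_of_pos Real.two_pi_pos] at h2
  have h3 : (1 : ℝ) ≤ |(n : ℝ)| := by exact_mod_cast Int.one_le_abs hn0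
  nlinarith [Real.two_pi_pos]

theorem expQuot_zero : expQuot 0 = 1 := by simp [expQuot, dslope_same]

theorem expQuot_ne_zero {z : ℂ} (hz : z ∈ strip) : expQuot z ≠ 0 := by
  rcases eq_or_ne z 0 with rfl | h0
  · simp [expQuot_zero]
  · intro h
    exact exp_sub_one_ne_zero hz h0 (by rw [← mul_expQuot, h, mul_zero])

theorem differentiableOn_todd : DifferentiableOn ℂ todd strip :=
  fun z hz => ((differentiable_expQuot z).inv (expQuot_ne_zero hz)).differentiableWithinAt

theorem differentiableOn_desKer : DifferentiableOn ℂ desKer strip :=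
  differentiableOn_todd.deriv isOpen_strip

theorem todd_of_ne {z : ℂ} (h0 : z ≠ 0) : todd z = z / (Complex.exp z - 1) := by
  rw [todd, ← mul_expQuot]
  rcases eq_or_ne (expQuot z) 0 with h | h
  · simp [h]
  · field_simp

/-- Differentiating `z * expQuot z = e ^ z - 1` twice at the origin gives `2 * expQuot'(0) = 1`. -/
theorem deriv_expQuot_zero : deriv expQuot 0 = 1 / 2 := by
  have h1 : ∀ z, expQuot z + z * deriv expQuot z = Complex.exp z := fun z => by
    have h2 : HasDerivAt (fun z => z * expQuot z) (1 * expQuot z + z * deriv expQuot z) z :=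
      (hasDerivAt_id z).mul (differentiable_expQuot z).hasDerivAt
    have h3 : HasDerivAt (fun z => z * expQuot z) (Complex.exp z) z := by
      simp_rw [mul_expQuot]
      exact (Complex.hasDerivAt_exp z).sub_const 1
    simpa using h2.unique h3
  have hd : DifferentiableAt ℂ (deriv expQuot) 0 :=
    (differentiable_expQuot.differentiableOn.deriv isOpen_univ).differentiableAt univ_mem
  have h4 : HasDerivAt (fun z => expQuot z + z * deriv expQuot z)
      (deriv expQuot 0 + (1 * deriv expQuot 0 + 0 * deriv (deriv expQuot) 0)) 0 :=
    (differentiable_expQuot 0).hasDerivAt.add ((hasDerivAt_id (0 : ℂ)).mul hd.hasDerivAt)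
  have h5 := h4.unique (by simp_rw [h1]; exact Complex.hasDerivAt_exp 0)
  rw [Complex.exp_zero] at h5
  linear_combination h5 / 2

theorem zero_mem_strip : (0 : ℂ) ∈ strip := by simp [strip, Real.pi_pos]

theorem desKer_zero : desKer 0 = -1 / 2 := by
  have h := ((differentiable_expQuot 0).hasDerivAt.inv (expQuot_ne_zero zero_mem_strip)).deriv
  rw [deriv_expQuot_zero, expQuot_zero] at h
  refine h.trans (by norm_num)

theorem desKer_of_ne {z : ℂ} (hz : z ∈ strip) (h0 : z ≠ 0) :
    desKer z = 1 / (Complex.exp z - 1) - z * Complex.exp z / (Complex.exp z - 1) ^ 2 := by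
  have hne := exp_sub_one_ne_zero hz h0
  have h : HasDerivAt (fun z => z / (Complex.exp z - 1))
      ((1 * (Complex.exp z - 1) - z * Complex.exp z) / (Complex.exp z - 1) ^ 2) z :=
    (hasDerivAt_id z).div ((Complex.hasDerivAt_exp z).sub_const 1) hne
  have he : todd =ᶠ[𝓝 z] fun z => z / (Complex.exp z - 1) := by
    filter_upwards [isOpen_ne.mem_nhds h0] with w hw using todd_of_ne hw
  rw [desKer, he.deriv_eq, h.deriv]
  field_simp

/-- Half-strips around the positive real axis. -/
def halfStrip (ρ : ℝ) : Set ℂ := {z | -ρ < z.re ∧ |z.im| < ρ}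

theorem isOpen_halfStrip (ρ : ℝ) : IsOpen (halfStrip ρ) :=
  (isOpen_lt continuous_const Complex.continuous_re).and
    (isOpen_lt Complex.continuous_im.abs continuous_const)

theorem halfStrip_subset_strip {ρ : ℝ} (hρ : ρ ≤ 2) : halfStrip ρ ⊆ strip := fun z hz => by
  have := hz.2
  have h3 := Real.pi_gt_three
  simp only [strip, Set.mem_ofPred_eq]
  linarith

/-- Compactness handles `Re z ≤ 1`; beyond it `desKer z` is of size at most `|z| e ^ (-Re z)`, and
half of the exponent absorbs the linear factor. The width 2 leaves room for multiples `l * y` with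
`y ∈ halfStrip 1` and `l ≤ 2`. -/
theorem exists_norm_desKer_le :
    ∃ C, 0 < C ∧ ∀ z ∈ halfStrip 2, ‖desKer z‖ ≤ C * Real.exp (-z.re / 2) := by
  have hK : IsCompact (Set.Icc (-2 : ℝ) 1 ×ℂ Set.Icc (-2 : ℝ) 2) := isCompact_Icc.reProdIm isCompact_Icc
  have hsub : (Set.Icc (-2 : ℝ) 1 ×ℂ Set.Icc (-2 : ℝ) 2) ⊆ strip := fun z hz => by
    have h3 := Real.pi_gt_three
    have : |z.im| ≤ 2 := abs_le.2 hz.2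
    simp only [strip, Set.mem_ofPred_eq]
    linarith
  obtain ⟨M, hM⟩ := hK.exists_bound_of_continuousOn (differentiableOn_desKer.continuousOn.mono hsub)
  have hM0 : 0 ≤ M := (norm_nonneg _).trans (hM 0 (by constructor <;> simp))
  -- The factor `e` compensates `e ^ (-Re z / 2)` on the compact part; 50 exceeds the `2 + 8` found
  -- on the tail.
  refine ⟨M * Real.exp 1 + 50, by positivity, fun z hz => ?_⟩
  have hE := Real.exp_pos (-z.re / 2)
  rcases le_total z.re 1 with h1 | h1
  · have hb := hM z ⟨⟨hz.1.le, h1⟩, abs_le.1 hz.2.le⟩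
    have h2 : 1 ≤ Real.exp 1 * Real.exp (-z.re / 2) := by
      rw [← Real.exp_add]
      exact Real.one_le_exp (by linarith)
    nlinarith
  · have h0 : z ≠ 0 := by rintro rfl; simp at h1; linarith
    rw [desKer_of_ne (halfStrip_subset_strip le_rfl hz) h0]
    set x := z.re with hx
    have hden : Real.exp x / 2 ≤ ‖Complex.exp z - 1‖ := by
      have h2 : ‖Complex.exp z‖ - ‖(1 : ℂ)‖ ≤ ‖Complex.exp z - 1‖ := norm_sub_norm_le _ _
      rw [Complex.norm_exp, norm_one, ← hx] at h2
      have h3 : x + 1 ≤ Real.exp x := Real.add_one_le_exp x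
      linarith
    have hEx := Real.exp_pos x
    have hz' : ‖z‖ ≤ x + 2 := by
      have := Complex.norm_le_abs_re_add_abs_im z
      rw [abs_of_pos (by linarith : 0 < z.re)] at this
      have := hz.2
      linarith
    have hsq : Real.exp (-x / 2) = 1 / Real.exp (x / 2) := by
      rw [one_div, ← Real.exp_neg]; ring_nf
    have hE2 : Real.exp x = Real.exp (x / 2) ^ 2 := by
      rw [← Real.exp_nat_mul]; ring_nf
    have hE2p := Real.exp_pos (x / 2)
    have h6 : x / 2 + 1 ≤ Real.exp (x / 2) := Real.add_one_le_exp _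
    have ha : ‖1 / (Complex.exp z - 1)‖ ≤ 2 * Real.exp (-x / 2) := by
      rw [norm_div, norm_one, hsq]
      calc 1 / ‖Complex.exp z - 1‖ ≤ 1 / (Real.exp x / 2) :=
            one_div_le_one_div_of_le (by positivity) hden
        _ ≤ 2 * (1 / Real.exp (x / 2)) := by
          rw [hE2, one_div_div, mul_one_div]
          gcongr
          nlinarith
    have hb : ‖z * Complex.exp z / (Complex.exp z - 1) ^ 2‖ ≤ 8 * Real.exp (-x / 2) := by
      rw [norm_div, norm_mul, norm_pow, Complex.norm_exp, ← hx, hsq]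
      calc ‖z‖ * Real.exp x / ‖Complex.exp z - 1‖ ^ 2
          ≤ (x + 2) * Real.exp x / (Real.exp x / 2) ^ 2 := by gcongr
        _ ≤ 8 * (1 / Real.exp (x / 2)) := by
          rw [hE2, mul_one_div, div_le_div_iff₀ (by positivity) hE2p]
          have : (x + 2) * Real.exp (x / 2) ≤ 2 * Real.exp (x / 2) ^ 2 := by nlinarith
          nlinarith [mul_le_mul_of_nonneg_left this (sq_nonneg (Real.exp (x / 2)))]
    calc _ ≤ 2 * Real.exp (-x / 2) + 8 * Real.exp (-x / 2) := (norm_sub_le _ _).trans (add_le_add ha hb)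
      _ ≤ _ := by nlinarith [mul_nonneg hM0 (Real.exp_pos 1).le]

/-! ### The kernel as a difference quotient, and its limit as `c → 1`. -/

theorem kernel_eq {c : ℝ} (hc : c ≠ 0) {y : ℂ} (h0 : y ≠ 0) :
    kernel c y = (todd y - todd (c * y)) / y := by
  have hc' : (c : ℂ) ≠ 0 := by exact_mod_cast hc
  rw [kernel, if_neg h0, todd_of_ne h0, todd_of_ne (mul_ne_zero hc' h0)]
  field_simp

theorem real_mul_mem_halfStrip {l : ℝ} (h0 : 0 < l) (h2 : l ≤ 2) {y : ℂ} (hy : y ∈ halfStrip 1) :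
    (l : ℂ) * y ∈ halfStrip 2 := by
  obtain ⟨h3, h4⟩ := hy
  simp only [halfStrip, Set.mem_ofPred_eq, Complex.re_ofReal_mul, Complex.im_ofReal_mul, abs_mul,
    abs_of_pos h0]
  constructor <;> nlinarith [abs_nonneg y.im]

/-- Mean value inequality for `todd` on the segment from `c * y` to `y`, whose points are `l * y`
with `1/2 ≤ l ≤ 2`. The factor `l ≥ 1/2` halves the decay rate 1/2 of `desKer`; this is the origin
of the rate 1/4 used throughout. -/
theorem exists_norm_kernel_div_le :
    ∃ C, 0 < C ∧ ∀ c ∈ Set.Ioo (1 / 2 : ℝ) 2, c ≠ 1 → ∀ y ∈ halfStrip 1,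
      ‖kernel c y / (1 - c)‖ ≤ C * Real.exp (-y.re / 4) := by
  obtain ⟨C, hC, hb⟩ := exists_norm_desKer_le
  refine ⟨C * Real.exp 1 + Real.exp 1, by positivity, fun c hc hc1 y hy => ?_⟩
  have hc1' : (1 - (c : ℂ)) ≠ 0 := by
    rw [sub_ne_zero]; exact_mod_cast hc1.symm
  rcases eq_or_ne y 0 with rfl | h0
  · have : kernel c 0 / (1 - c) = -1 / 2 := by
      rw [kernel, if_pos rfl]; field_simp; ring
    rw [this]
    have := Real.add_one_le_exp (1 : ℝ)
    norm_num
    nlinarith [Real.exp_pos 1]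
  rw [kernel_eq (by linarith [hc.1]) h0]
  have hseg : ∀ z ∈ segment ℝ ((c : ℂ) * y) y, ∃ l ∈ Set.Icc (1 / 2 : ℝ) 2, z = l * y := by
    rintro _ ⟨a, b, ha, hb, hab, rfl⟩
    refine ⟨a * c + b, ⟨by nlinarith [hc.1], by nlinarith [hc.2]⟩, ?_⟩
    simp only [Complex.real_smul]
    push_cast
    ring
  have hmv := (convex_segment ((c : ℂ) * y) y).norm_image_sub_le_of_norm_deriv_le
    (f := todd) (C := C * (Real.exp 1 * Real.exp (-y.re / 4))) (𝕜 := ℂ) (x := (c : ℂ) * y) (y := y)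
    (fun z hz => ?_) (fun z hz => ?_) (left_mem_segment _ _ _) (right_mem_segment _ _ _)
  · have h5 : y - c * y = (1 - c) * y := by ring
    rw [h5, norm_mul] at hmv
    rw [norm_div, norm_div, div_div, div_le_iff₀ (by positivity)]
    refine hmv.trans ?_
    have := Real.exp_pos (-y.re / 4)
    have h7 : 0 ≤ ‖1 - (c : ℂ)‖ * ‖y‖ := by positivity
    nlinarith [mul_nonneg (mul_pos (Real.exp_pos 1) this).le h7]
  · obtain ⟨l, hl, rfl⟩ := hseg z hz
    exact differentiableOn_todd.differentiableAt (isOpen_strip.mem_nhds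
      (halfStrip_subset_strip le_rfl (real_mul_mem_halfStrip (by linarith [hl.1]) hl.2 hy)))
  · obtain ⟨l, hl, rfl⟩ := hseg z hz
    refine (hb _ (real_mul_mem_halfStrip (by linarith [hl.1]) hl.2 hy)).trans ?_
    rw [← Real.exp_add, Complex.re_ofReal_mul]
    gcongr
    have := hy.1
    rcases le_total y.re 0 with h | h <;> nlinarith [hl.1, hl.2]

/-- For `y ≠ 0` this is the derivative of `c ↦ todd (c * y)` at 1, divided by `y`. -/
theorem tendsto_kernel_div {y : ℂ} (hy : y ∈ strip) :
    Tendsto (fun c : ℝ => kernel c y / (1 - c)) (𝓝[≠] 1) (𝓝 (desKer y)) := by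
  rcases eq_or_ne y 0 with rfl | h0
  · rw [desKer_zero]
    refine tendsto_const_nhds.congr' ?_
    filter_upwards [self_mem_nhdsWithin] with c hc
    have hc1' : (1 - (c : ℂ)) ≠ 0 := by
      rw [sub_ne_zero]; exact_mod_cast (Ne.symm hc)
    rw [kernel, if_pos rfl]; field_simp; ring
  have h1 : HasDerivAt (fun c : ℝ => todd (c * y)) (desKer y * y) 1 := by
    have h2 : HasDerivAt todd (desKer y) (((1 : ℝ) : ℂ) * y) := by
      rw [Complex.ofReal_one, one_mul]
      exact (differentiableOn_todd.differentiableAt (isOpen_strip.mem_nhds hy)).hasDerivAt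
    have h3 : HasDerivAt (fun c : ℝ => (c : ℂ) * y) y 1 := by
      simpa using (Complex.ofRealCLM.hasDerivAt (x := 1)).mul_const y
    exact HasDerivAt.comp (h₂ := todd) (1 : ℝ) h2 h3
  have h4 := (hasDerivAt_iff_tendsto_slope.1 h1).div_const y
  rw [mul_div_cancel_right₀ _ h0] at h4
  refine h4.congr' ?_
  filter_upwards [self_mem_nhdsWithin, nhdsWithin_le_nhds (lt_mem_nhds (one_pos (α := ℝ)))]
    with c hc hc0
  have hc1' : (1 - (c : ℂ)) ≠ 0 := by
    rw [sub_ne_zero]; exact_mod_cast (Ne.symm hc)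
  have hc1'' : ((c : ℂ) - 1) ≠ 0 := by
    rw [sub_ne_zero]; exact_mod_cast hc
  rw [kernel_eq hc0.ne' h0, slope_def_module, Complex.ofReal_one, one_mul, Complex.real_smul]
  push_cast
  field_simp
  ring

theorem measurable_kernel (c : ℝ) : Measurable (kernel c) := by
  unfold kernel
  refine Measurable.ite (measurableSet_singleton 0) measurable_const ?_
  fun_prop

theorem measurable_desKer : Measurable desKer := measurable_deriv _

/-! ### Holomorphic dependence of integrals on parameters. -/

/-- Each directional derivative is a limit of difference quotients with steps `1 / (n + 1)`, hence
measurable, and a basis reassembles the full derivative. -/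
theorem aestronglyMeasurable_fderiv {E α : Type*} [NormedAddCommGroup E] [NormedSpace ℂ E]
    [FiniteDimensional ℂ E] [MeasurableSpace α] {μ : Measure α} {F : E → α → ℂ} {V : Set E} {p : E}
    (hV : V ∈ 𝓝 p) (hmeas : ∀ q ∈ V, AEStronglyMeasurable (F q) μ)
    (hd : ∀ a, DifferentiableAt ℂ (F · a) p) :
    AEStronglyMeasurable (fun a => fderiv ℂ (F · a) p) μ := by
  have hdir : ∀ v : E, AEStronglyMeasurable (fun a => fderiv ℂ (F · a) p v) μ := fun v => by
    have hlim : Tendsto (fun n : ℕ => ((n : ℂ) + 1)⁻¹) atTop (𝓝[≠] 0) := by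
      refine tendsto_nhdsWithin_iff.2 ⟨?_, Eventually.of_forall fun n => ?_⟩
      · have := tendsto_one_div_add_atTop_nhds_zero_nat (𝕜 := ℂ)
        simpa using this
      · exact inv_ne_zero (by exact_mod_cast n.succ_ne_zero)
    have hline : Tendsto (fun n : ℕ => p + ((n : ℂ) + 1)⁻¹ • v) atTop (𝓝 p) := by
      have := ((hlim.mono_right nhdsWithin_le_nhds).smul_const v).const_add p
      simpa using this
    obtain ⟨N, hN⟩ := eventually_atTop.1 (hline.eventually hV)
    refine aestronglyMeasurable_of_tendsto_ae atTop
      (f := fun n a => (((n + N : ℕ) : ℂ) + 1) * (F (p + (((n + N : ℕ) : ℂ) + 1)⁻¹ • v) a - F p a))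
      (fun n => ?_) (ae_of_all _ fun a => ?_)
    · exact ((hmeas _ (hN _ (Nat.le_add_left _ _))).sub (hmeas p (mem_of_mem_nhds hV))).const_mul _
    · have h1 := (hd a).hasFDerivAt.hasLineDerivAt v
      have h2 := (hasDerivAt_iff_tendsto_slope.1 h1).comp (hlim.comp (tendsto_add_atTop_nat N))
      refine h2.congr fun n => ?_
      simp only [Function.comp_apply, slope_def_field, zero_smul, add_zero, sub_zero]
      rw [div_inv_eq_mul, mul_comm]
  let b := Module.finBasis ℂ E
  have heq : (fun a => fderiv ℂ (F · a) p) = fun a =>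
      ∑ i, (LinearMap.toContinuousLinearMap (b.coord i)).smulRight (fderiv ℂ (F · a) p (b i)) := by
    funext a
    refine ContinuousLinearMap.coe_injective (b.ext fun j => ?_)
    simp [Finsupp.single_apply]
  rw [heq]
  refine Finset.aestronglyMeasurable_fun_sum _ fun i _ => ?_
  have hc : Continuous fun z : ℂ =>
      (LinearMap.toContinuousLinearMap (b.coord i)).smulRight z :=
    (ContinuousLinearMap.smulRightL ℂ E ℂ (LinearMap.toContinuousLinearMap (b.coord i))).continuous
  exact hc.comp_aestronglyMeasurable (hdir (b i))

/-- An integral that depends holomorphically on a parameter and is dominated locally uniformly is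
holomorphic in the parameter. -/
theorem differentiableAt_integral {E α : Type*} [NormedAddCommGroup E] [NormedSpace ℂ E]
    [FiniteDimensional ℂ E] [MeasurableSpace α] {μ : Measure α} {F : E → α → ℂ} {V : Set E} {p : E}
    {bound : α → ℝ}
    (hV : V ∈ 𝓝 p) (hmeas : ∀ q ∈ V, AEStronglyMeasurable (F q) μ)
    (hd : ∀ a, DifferentiableOn ℂ (F · a) V) (hb : ∀ a, ∀ q ∈ V, ‖F q a‖ ≤ bound a)
    (hint : Integrable bound μ) :
    DifferentiableAt ℂ (fun q => ∫ a, F q a ∂μ) p := by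
  obtain ⟨R, hR, hRV⟩ := Metric.mem_nhds_iff.1 hV
  have hsub : ∀ q ∈ Metric.ball p (R / 2), Metric.ball q (R / 2) ⊆ V := fun q hq =>
    (Metric.ball_subset_ball' (by rw [Metric.mem_ball] at hq; linarith)).trans hRV
  refine (hasFDerivAt_integral_of_dominated_of_fderiv_le (F' := fun q a => fderiv ℂ (F · a) q)
    (bound := fun a => 2 * bound a / (R / 2)) (Metric.ball_mem_nhds p (half_pos hR)) ?_ ?_ ?_ ?_ ?_
    ?_).differentiableAt
  · filter_upwards [hV] with q hq using hmeas q hq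
  · exact hint.mono' (hmeas p (mem_of_mem_nhds hV)) (ae_of_all _ fun a => hb a p (mem_of_mem_nhds hV))
  · exact aestronglyMeasurable_fderiv hV hmeas fun a => (hd a).differentiableAt hV
  · refine ae_of_all _ fun a q hq => ?_
    -- A Cauchy-type estimate: on the ball of radius `R / 2` about `q` the function moves by at most
    -- `2 * bound a`. A bound on the function thus already dominates its derivative.
    refine Complex.norm_fderiv_le_div_of_mapsTo_ball ((hd a).mono (hsub q hq)) (fun z hz => ?_)
      (half_pos hR)
    rw [Metric.mem_closedBall, dist_eq_norm]
    have h1 := hb a z (hsub q hq hz)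
    have h2 := hb a q (hsub q hq (Metric.mem_ball_self (half_pos hR)))
    linarith [norm_sub_le (F z a) (F q a)]
  · exact (hint.const_mul 2).div_const _
  · refine ae_of_all _ fun a q hq => ?_
    exact ((hd a).differentiableAt (mem_of_superset
      (Metric.ball_mem_nhds q (half_pos hR)) (hsub q hq))).hasFDerivAt

/-! ### Iterated integrals along weighted paths. -/

/-- A weighted path in the `δ`-neighbourhood of the positive real axis. -/
structure IsContour (δ : ℝ) (p w : ℝ → ℂ) : Prop where
  measurable_path : Measurable p
  measurable_weight : Measurable w
  le_re : ∀ u, -δ ≤ (p u).re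
  abs_im_le : ∀ u, |(p u).im| ≤ δ
  integrable : Integrable fun u => ‖w u‖ * Real.exp (-(p u).re / 4)

/-- The integrand of `iterInt`. -/
def iterIntegrand (r : ℕ) (g : ℂ → ℂ) (p w : Fin r → ℝ → ℂ) (y : ℂ) (u : Fin r → ℝ) : ℂ :=
  (∏ j, g (y + ∑ k ∈ Finset.Ici j, p k (u k))) * ∏ k, w k (u k)

/-- The integral of `∏ⱼ g (y + tⱼ + ⋯ + tᵣ)` along a product of weighted paths. -/
def iterInt (r : ℕ) (g : ℂ → ℂ) (p w : Fin r → ℝ → ℂ) (y : ℂ) : ℂ :=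
  ∫ u : Fin r → ℝ, iterIntegrand r g p w y u

section

variable {r : ℕ} {g : ℂ → ℂ} {p w : Fin r → ℝ → ℂ} {δ ρ C : ℝ} {y : ℂ}

theorem measurable_iterIntegrand (hg : Measurable g) (hp : ∀ k, Measurable (p k))
    (hw : ∀ k, Measurable (w k)) (y : ℂ) : Measurable (iterIntegrand r g p w y) := by
  unfold iterIntegrand
  fun_prop

/-- Each variable uses up at most `δ` of the strip, so the budget `ρ + r * δ ≤ 1` keeps all tail
sums in `halfStrip 1`. The second bound lets the `j`-th factor pay for the `j`-th variable. -/
theorem tail_sum_bounds (hδ : 0 ≤ δ) (hρ : ρ + r * δ ≤ 1) (hy : y ∈ halfStrip ρ) {z : Fin r → ℂ}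
    (hre : ∀ k, -δ ≤ (z k).re) (him : ∀ k, |(z k).im| ≤ δ) (j : Fin r) :
    y + ∑ k ∈ Finset.Ici j, z k ∈ halfStrip 1 ∧
      (z j).re - 1 ≤ (y + ∑ k ∈ Finset.Ici j, z k).re := by
  have hcard : ((Finset.Ici j).card : ℝ) * δ ≤ r * δ := by
    gcongr
    simp
  have h1 : (z j).re + δ ≤ ∑ k ∈ Finset.Ici j, ((z k).re + δ) :=
    Finset.single_le_sum (f := fun k => (z k).re + δ) (fun k _ => by linarith [hre k])
      (Finset.mem_Ici.2 le_rfl)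
  rw [Finset.sum_add_distrib, Finset.sum_const, nsmul_eq_mul] at h1
  have h2 : |∑ k ∈ Finset.Ici j, (z k).im| ≤ (Finset.Ici j).card * δ := by
    refine (Finset.abs_sum_le_sum_abs _ _).trans ?_
    rw [← nsmul_eq_mul, ← Finset.sum_const]
    exact Finset.sum_le_sum fun k _ => him k
  obtain ⟨hy1, hy2⟩ := hy
  have h3 := hre j
  refine ⟨⟨?_, ?_⟩, ?_⟩
  · rw [Complex.add_re, Complex.re_sum]; linarith
  · rw [Complex.add_im, Complex.im_sum]
    linarith [abs_add_le y.im (∑ k ∈ Finset.Ici j, (z k).im)]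
  · rw [Complex.add_re, Complex.re_sum]; linarith

/-- Pairing the `j`-th factor with the `j`-th weight gives a majorant that is independent of `y` and
a product of one-variable functions. The factor `e ^ (1/4)` is the loss of 1 in `tail_sum_bounds`.
-/
theorem norm_iterIntegrand_le (hδ : 0 ≤ δ) (hρ : ρ + r * δ ≤ 1) (hC : 0 ≤ C)
    (hb : ∀ z ∈ halfStrip 1, ‖g z‖ ≤ C * Real.exp (-z.re / 4))
    (hre : ∀ k u, -δ ≤ (p k u).re) (him : ∀ k u, |(p k u).im| ≤ δ)
    (hy : y ∈ halfStrip ρ) (u : Fin r → ℝ) :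
    ‖iterIntegrand r g p w y u‖ ≤
      ∏ k, (C * Real.exp (1 / 4)) * (‖w k (u k)‖ * Real.exp (-(p k (u k)).re / 4)) := by
  rw [iterIntegrand, norm_mul, norm_prod, norm_prod, ← Finset.prod_mul_distrib]
  refine Finset.prod_le_prod (fun _ _ => by positivity) fun j _ => ?_
  obtain ⟨h1, h2⟩ := tail_sum_bounds hδ hρ hy (z := fun k => p k (u k)) (fun k => hre k _)
    (fun k => him k _) j
  have h3 : ‖g (y + ∑ k ∈ Finset.Ici j, p k (u k))‖ ≤
      C * (Real.exp (1 / 4) * Real.exp (-(p j (u j)).re / 4)) := by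
    refine (hb _ h1).trans ?_
    rw [← Real.exp_add]
    gcongr
    linarith
  calc _ ≤ C * (Real.exp (1 / 4) * Real.exp (-(p j (u j)).re / 4)) * ‖w j (u j)‖ := by gcongr
    _ = _ := by ring

theorem integrable_majorant (C : ℝ) (hpw : ∀ k, IsContour δ (p k) (w k)) :
    Integrable fun u : Fin r → ℝ =>
      ∏ k, (C * Real.exp (1 / 4)) * (‖w k (u k)‖ * Real.exp (-(p k (u k)).re / 4)) :=
  Integrable.fintype_prod
    (f := fun k x => (C * Real.exp (1 / 4)) * (‖w k x‖ * Real.exp (-(p k x).re / 4)))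
    fun k => (hpw k).integrable.const_mul _

theorem integrable_iterIntegrand (hδ : 0 ≤ δ) (hρ : ρ + r * δ ≤ 1) (hC : 0 ≤ C) (hg : Measurable g)
    (hb : ∀ z ∈ halfStrip 1, ‖g z‖ ≤ C * Real.exp (-z.re / 4))
    (hpw : ∀ k, IsContour δ (p k) (w k)) (hy : y ∈ halfStrip ρ) :
    Integrable (iterIntegrand r g p w y) :=
  (integrable_majorant C hpw).mono'
    (measurable_iterIntegrand hg (fun k => (hpw k).measurable_path)
      (fun k => (hpw k).measurable_weight) y).aestronglyMeasurable
    (ae_of_all _ fun u => norm_iterIntegrand_le hδ hρ hC hb (fun k => (hpw k).le_re)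
      (fun k => (hpw k).abs_im_le) hy u)

theorem exists_norm_iterInt_le (hδ : 0 ≤ δ) (hρ : ρ + r * δ ≤ 1) (hC : 0 ≤ C)
    (hb : ∀ z ∈ halfStrip 1, ‖g z‖ ≤ C * Real.exp (-z.re / 4))
    (hpw : ∀ k, IsContour δ (p k) (w k)) :
    ∃ M, 0 ≤ M ∧ ∀ y ∈ halfStrip ρ, ‖iterInt r g p w y‖ ≤ M :=
  ⟨_, integral_nonneg fun u => Finset.prod_nonneg fun k _ => by positivity, fun y hy =>
    norm_integral_le_of_norm_le (integrable_majorant C hpw) (ae_of_all _ fun u =>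
      norm_iterIntegrand_le hδ hρ hC hb (fun k => (hpw k).le_re) (fun k => (hpw k).abs_im_le) hy u)⟩

theorem differentiableOn_iterInt (hδ : 0 ≤ δ) (hρ : ρ + r * δ ≤ 1) (hC : 0 ≤ C) (hg : Measurable g)
    (hd : DifferentiableOn ℂ g (halfStrip 1))
    (hb : ∀ z ∈ halfStrip 1, ‖g z‖ ≤ C * Real.exp (-z.re / 4))
    (hpw : ∀ k, IsContour δ (p k) (w k)) :
    DifferentiableOn ℂ (iterInt r g p w) (halfStrip ρ) := by
  intro y hy
  refine (differentiableAt_integral ((isOpen_halfStrip ρ).mem_nhds hy)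
    (fun q _ => (measurable_iterIntegrand hg (fun k => (hpw k).measurable_path)
      (fun k => (hpw k).measurable_weight) q).aestronglyMeasurable) (fun u => ?_)
    (fun u q hq => norm_iterIntegrand_le hδ hρ hC hb (fun k => (hpw k).le_re)
      (fun k => (hpw k).abs_im_le) hq u) (integrable_majorant C hpw)).differentiableWithinAt
  unfold iterIntegrand
  refine DifferentiableOn.mul (DifferentiableOn.fun_finsetProd fun j _ => ?_)
    (differentiableOn_const _)
  exact hd.comp (differentiableOn_id.add_const _) fun q hq =>
    (tail_sum_bounds hδ hρ hq (z := fun k => p k (u k)) (fun k => (hpw k).le_re _)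
    (fun k => (hpw k).abs_im_le _) j).1

theorem iterInt_zero (g : ℂ → ℂ) (p w : Fin 0 → ℝ → ℂ) (y : ℂ) : iterInt 0 g p w y = 1 := by
  simp [iterInt, iterIntegrand, measureReal_def, volume_pi]

end

/-- The last variable occurs in every tail sum, so for the remaining variables it only translates
the base point. This is why `y` is carried along. -/
theorem iterIntegrand_snoc {r : ℕ} (g : ℂ → ℂ) (p w : Fin (r + 1) → ℝ → ℂ) (y : ℂ)
    (v : Fin r → ℝ) (x : ℝ) :
    iterIntegrand (r + 1) g p w y (Fin.snoc (α := fun _ => ℝ) v x) =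
      g (y + p (Fin.last r) x) * w (Fin.last r) x *
        iterIntegrand r g (Fin.init p) (Fin.init w) (y + p (Fin.last r) x) v := by
  have hsum : ∀ j : Fin (r + 1),
      ∑ k ∈ Finset.Ici j, p k (Fin.snoc (α := fun _ => ℝ) v x k) =
        ∑ k : Fin r, (if j ≤ k.castSucc then p k.castSucc (v k) else 0) + p (Fin.last r) x := by
    intro j
    rw [← Finset.filter_le_eq_Ici, Finset.sum_filter, Fin.sum_univ_castSucc]
    simp [Fin.le_last]
  have hsum' : ∀ j : Fin r, ∑ k ∈ Finset.Ici j, Fin.init p k (v k) =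
      ∑ k : Fin r, (if j ≤ k then p k.castSucc (v k) else 0) := by
    intro j
    rw [← Finset.filter_le_eq_Ici, Finset.sum_filter]
    rfl
  simp only [iterIntegrand, Fin.prod_univ_castSucc, hsum, hsum', Fin.snoc_castSucc, Fin.snoc_last,
    Fin.castSucc_le_castSucc_iff]
  have hlast : ∀ k : Fin r, ¬ Fin.last r ≤ k.castSucc := fun k => not_le.2 (Fin.castSucc_lt_last k)
  simp only [hlast, if_false, Finset.sum_const_zero, zero_add]
  have : ∀ a : ℂ, y + (a + p (Fin.last r) x) = y + p (Fin.last r) x + a := fun a => by ring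
  simp only [this, Fin.init]
  ring

/-- The last integration of an iterated integral, performed last. -/
theorem iterInt_succ {r : ℕ} {g : ℂ → ℂ} {p w : Fin (r + 1) → ℝ → ℂ} {y : ℂ}
    (hint : Integrable (iterIntegrand (r + 1) g p w y)) :
    iterInt (r + 1) g p w y = ∫ x : ℝ, g (y + p (Fin.last r) x) *
      iterInt r g (Fin.init p) (Fin.init w) (y + p (Fin.last r) x) * w (Fin.last r) x := by
  have hmp := (volume_preserving_piFinSuccAbove (fun _ : Fin (r + 1) => ℝ) (Fin.last r)).symm
  have hfun : ∀ q : ℝ × (Fin r → ℝ),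
      iterIntegrand (r + 1) g p w y
        ((MeasurableEquiv.piFinSuccAbove (fun _ : Fin (r + 1) => ℝ) (Fin.last r)).symm q) =
      g (y + p (Fin.last r) q.1) * w (Fin.last r) q.1 *
        iterIntegrand r g (Fin.init p) (Fin.init w) (y + p (Fin.last r) q.1) q.2 := fun q => by
    rw [← iterIntegrand_snoc]
    congr 1
    ext k
    simp [MeasurableEquiv.piFinSuccAbove, Fin.insertNthEquiv, Fin.insertNth_last']
  have hint' := (hmp.integrable_comp_emb (MeasurableEquiv.measurableEmbedding _)).2 hint
  rw [iterInt, ← hmp.integral_comp']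
  simp only [Function.comp_def, hfun] at hint' ⊢
  rw [Measure.volume_eq_prod, integral_prod _ hint']
  refine integral_congr_ae (ae_of_all _ fun x => ?_)
  simp only [integral_const_mul, iterInt]
  ring

/-! ### Replacing the paths in an iterated integral. -/

/-- Two weighted paths are equivalent if holomorphic functions with exponential decay have the same
integrals along both. -/
def ContourEquiv (δ : ℝ) (p w p' w' : ℝ → ℂ) : Prop :=
  ∀ (ρ : ℝ) (f : ℂ → ℂ), DifferentiableOn ℂ f (halfStrip (ρ + δ)) →
    (∃ C, 0 ≤ C ∧ ∀ z ∈ halfStrip (ρ + δ), ‖f z‖ ≤ C * Real.exp (-z.re / 4)) →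
    ∀ y ∈ halfStrip ρ, ∫ x, f (y + p x) * w x = ∫ x, f (y + p' x) * w' x

theorem ContourEquiv.symm {δ : ℝ} {p w p' w' : ℝ → ℂ} (h : ContourEquiv δ p w p' w') :
    ContourEquiv δ p' w' p w := fun ρ f hf hb y hy => (h ρ f hf hb y hy).symm

theorem halfStrip_mono {a b : ℝ} (h : a ≤ b) : halfStrip a ⊆ halfStrip b := fun _ hz =>
  ⟨by linarith [hz.1], by linarith [hz.2]⟩

theorem add_mem_halfStrip {δ ρ : ℝ} {y z : ℂ} (hy : y ∈ halfStrip ρ) (h1 : -δ ≤ z.re)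
    (h2 : |z.im| ≤ δ) : y + z ∈ halfStrip (ρ + δ) := by
  obtain ⟨h3, h4⟩ := hy
  refine ⟨?_, ?_⟩
  · rw [Complex.add_re]; linarith
  · rw [Complex.add_im]; linarith [abs_add_le y.im z.im]

theorem exists_norm_mul_iterInt_le {r : ℕ} {g : ℂ → ℂ} {p w : Fin r → ℝ → ℂ} {δ ρ C : ℝ}
    (hδ : 0 ≤ δ) (hρ : ρ + r * δ ≤ 1) (hC : 0 ≤ C)
    (hb : ∀ z ∈ halfStrip 1, ‖g z‖ ≤ C * Real.exp (-z.re / 4))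
    (hpw : ∀ k, IsContour δ (p k) (w k)) :
    ∃ C', 0 ≤ C' ∧ ∀ z ∈ halfStrip ρ, ‖g z * iterInt r g p w z‖ ≤ C' * Real.exp (-z.re / 4) := by
  obtain ⟨M, hM, hM'⟩ := exists_norm_iterInt_le hδ hρ hC hb hpw
  have hρ1 : ρ ≤ 1 := by
    have : 0 ≤ r * δ := by positivity
    linarith
  refine ⟨C * M, by positivity, fun z hz => ?_⟩
  rw [norm_mul]
  calc _ ≤ C * Real.exp (-z.re / 4) * M := by
        gcongr
        · exact hb z (halfStrip_mono hρ1 hz)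
        · exact hM' z hz
    _ = _ := by ring

theorem differentiableOn_mul_iterInt {r : ℕ} {g : ℂ → ℂ} {p w : Fin r → ℝ → ℂ} {δ ρ C : ℝ}
    (hδ : 0 ≤ δ) (hρ : ρ + r * δ ≤ 1) (hC : 0 ≤ C) (hg : Measurable g)
    (hd : DifferentiableOn ℂ g (halfStrip 1))
    (hb : ∀ z ∈ halfStrip 1, ‖g z‖ ≤ C * Real.exp (-z.re / 4))
    (hpw : ∀ k, IsContour δ (p k) (w k)) :
    DifferentiableOn ℂ (fun z => g z * iterInt r g p w z) (halfStrip ρ) := by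
  have hρ1 : ρ ≤ 1 := by
    have : 0 ≤ r * δ := by positivity
    linarith
  exact (hd.mono (halfStrip_mono hρ1)).mul (differentiableOn_iterInt hδ hρ hC hg hd hb hpw)

/-- Induction on the depth: the inner integral is changed at the translated base point, after which
the outer path is changed for the holomorphic decaying function `g * iterInt r g`. Each layer widens
the half-strip by `δ`, so `ρ` varies in the induction. -/
theorem iterInt_congr {r : ℕ} {g : ℂ → ℂ} {p w p' w' : Fin r → ℝ → ℂ} {δ ρ C : ℝ} {y : ℂ}
    (hδ : 0 ≤ δ) (hρ : ρ + r * δ ≤ 1) (hC : 0 ≤ C) (hg : Measurable g)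
    (hd : DifferentiableOn ℂ g (halfStrip 1))
    (hb : ∀ z ∈ halfStrip 1, ‖g z‖ ≤ C * Real.exp (-z.re / 4))
    (hpw : ∀ k, IsContour δ (p k) (w k)) (hpw' : ∀ k, IsContour δ (p' k) (w' k))
    (he : ∀ k, ContourEquiv δ (p k) (w k) (p' k) (w' k)) (hy : y ∈ halfStrip ρ) :
    iterInt r g p w y = iterInt r g p' w' y := by
  induction r generalizing ρ y with
  | zero => rw [iterInt_zero, iterInt_zero]
  | succ r ih =>
    rw [iterInt_succ (integrable_iterIntegrand hδ hρ hC hg hb hpw hy),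
      iterInt_succ (integrable_iterIntegrand hδ hρ hC hg hb hpw' hy)]
    have hρ' : (ρ + δ) + r * δ ≤ 1 := by
      push_cast at hρ; linarith
    have h1 : ∀ x, iterInt r g (Fin.init p) (Fin.init w) (y + p (Fin.last r) x) =
        iterInt r g (Fin.init p') (Fin.init w') (y + p (Fin.last r) x) := fun x =>
      ih hρ' (fun k => hpw k.castSucc) (fun k => hpw' k.castSucc) (fun k => he k.castSucc)
        (add_mem_halfStrip hy ((hpw _).le_re x) ((hpw _).abs_im_le x))
    simp only [h1]
    exact he (Fin.last r) ρ _
      (differentiableOn_mul_iterInt hδ hρ' hC hg hd hb fun k => hpw' k.castSucc)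
      (exists_norm_mul_iterInt_le hδ hρ' hC hb fun k => hpw' k.castSucc) y hy

/-! ### Weights depending holomorphically on an exponent. -/

/-- A family of weights on a path which is holomorphic in a parameter and locally uniformly
dominated. -/
structure IsContourFamily (δ : ℝ) (p : ℝ → ℂ) (w : ℂ → ℝ → ℂ) (D : Set ℂ) : Prop where
  measurable_path : Measurable p
  measurable_weight : ∀ s, Measurable (w s)
  le_re : ∀ u, -δ ≤ (p u).re
  abs_im_le : ∀ u, |(p u).im| ≤ δ
  differentiableOn : ∀ u, DifferentiableOn ℂ (fun s => w s u) D
  dominated : ∀ s ∈ D, ∃ V ∈ 𝓝 s, ∃ B : ℝ → ℝ, (∀ q ∈ V, ∀ u, ‖w q u‖ ≤ B u) ∧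
    Integrable fun u => B u * Real.exp (-(p u).re / 4)

theorem IsContourFamily.isContour {δ : ℝ} {p : ℝ → ℂ} {w : ℂ → ℝ → ℂ} {D : Set ℂ}
    (h : IsContourFamily δ p w D) {s : ℂ} (hs : s ∈ D) : IsContour δ p (w s) where
  measurable_path := h.measurable_path
  measurable_weight := h.measurable_weight s
  le_re := h.le_re
  abs_im_le := h.abs_im_le
  integrable := by
    obtain ⟨V, hV, B, hB, hint⟩ := h.dominated s hs
    have hp := h.measurable_path
    have hw := h.measurable_weight s
    refine hint.mono' (by fun_prop) (ae_of_all _ fun u => ?_)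
    rw [Real.norm_of_nonneg (by positivity)]
    gcongr
    exact hB s (mem_of_mem_nhds hV) u

theorem IsContourFamily.mul_left {δ : ℝ} {p : ℝ → ℂ} {w : ℂ → ℝ → ℂ} {D D' : Set ℂ}
    (h : IsContourFamily δ p w D) {κ : ℂ → ℂ} (hD' : IsOpen D') (hsub : D' ⊆ D)
    (hκ : DifferentiableOn ℂ κ D') :
    IsContourFamily δ p (fun s u => κ s * w s u) D' where
  measurable_path := h.measurable_path
  measurable_weight s := (h.measurable_weight s).const_mul _
  le_re := h.le_re
  abs_im_le := h.abs_im_le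
  differentiableOn u := hκ.mul ((h.differentiableOn u).mono hsub)
  dominated s hs := by
    obtain ⟨V, hV, B, hB, hint⟩ := h.dominated s (hsub hs)
    have hc : ∀ᶠ q in 𝓝 s, ‖κ q‖ < ‖κ s‖ + 1 :=
      ((hκ.continuousOn.continuousAt (hD'.mem_nhds hs)).norm).eventually_lt_const (by linarith)
    refine ⟨_, inter_mem hV hc, fun u => (‖κ s‖ + 1) * B u, fun q hq u => ?_, ?_⟩
    · rw [norm_mul]
      have h1 := hB q hq.1 u
      have h2 : ‖κ q‖ < ‖κ s‖ + 1 := hq.2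
      exact mul_le_mul h2.le h1 (norm_nonneg _) (by positivity)
    · simpa only [mul_assoc] using hint.const_mul (‖κ s‖ + 1)

theorem IsContour.integrable_mul {δ ρ : ℝ} {p w : ℝ → ℂ} (h : IsContour δ p w) {f : ℂ → ℂ}
    (hf : ContinuousOn f (halfStrip (ρ + δ)))
    (hb : ∃ C, 0 ≤ C ∧ ∀ z ∈ halfStrip (ρ + δ), ‖f z‖ ≤ C * Real.exp (-z.re / 4)) {y : ℂ}
    (hy : y ∈ halfStrip ρ) : Integrable fun x => f (y + p x) * w x := by
  classical
  obtain ⟨C, hC, hb⟩ := hb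
  have hmem : ∀ x, y + p x ∈ halfStrip (ρ + δ) := fun x =>
    add_mem_halfStrip hy (h.le_re x) (h.abs_im_le x)
  -- Nothing is known about `f` outside the half-strip; since the path stays inside, `f` may be
  -- replaced by its extension by zero.
  have hm : Measurable ((halfStrip (ρ + δ)).piecewise f fun _ => 0) :=
    hf.measurable_piecewise continuousOn_const (isOpen_halfStrip _).measurableSet
  have hm' : Measurable fun x => f (y + p x) := by
    have := hm.comp (h.measurable_path.const_add y)
    convert this using 1
    funext x
    simp [Set.piecewise, hmem x]
  refine (h.integrable.const_mul (C * Real.exp (-y.re / 4))).mono'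
    (hm'.mul h.measurable_weight).aestronglyMeasurable (ae_of_all _ fun x => ?_)
  rw [norm_mul]
  calc _ ≤ C * Real.exp (-(y + p x).re / 4) * ‖w x‖ := by
        gcongr; exact hb _ (hmem x)
    _ = _ := by
        rw [Complex.add_re, neg_add, add_div, Real.exp_add]; ring

/-! ### The real half-line -/

/-- The path along the positive real axis. -/
def rayPath (u : ℝ) : ℂ := ((max u 0 : ℝ) : ℂ)

/-- The weight `u ^ (s - 1)` on the positive real axis. -/
def rayWeight (s : ℂ) : ℝ → ℂ :=
  (Set.Ioi 0).indicator fun u => Complex.exp ((s - 1) * (Real.log u : ℂ))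

theorem norm_exp_mul_log {a : ℂ} {x : ℝ} (hx : 0 < x) :
    ‖Complex.exp (a * (Real.log x : ℂ))‖ = x ^ a.re := by
  rw [Complex.norm_exp, Complex.re_mul_ofReal, Real.rpow_def_of_pos hx, mul_comm]

theorem isContourFamily_ray {δ : ℝ} (hδ : 0 ≤ δ) :
    IsContourFamily δ rayPath rayWeight {s | 0 < s.re} where
  measurable_path := by unfold rayPath; fun_prop
  measurable_weight s := by
    unfold rayWeight
    refine Measurable.indicator ?_ measurableSet_Ioi
    have := Real.measurable_log
    fun_prop
  le_re u := by
    rw [rayPath, Complex.ofReal_re]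
    linarith [le_max_right u 0]
  abs_im_le u := by simpa [rayPath] using hδ
  differentiableOn u := by
    by_cases hu : u ∈ Set.Ioi (0 : ℝ)
    · simp only [rayWeight, Set.indicator_of_mem hu]
      fun_prop
    · simp only [rayWeight, Set.indicator_of_notMem hu]
      fun_prop
  dominated s hs := by
    have hs' : 0 < s.re := hs
    have hint : ∀ a : ℝ, 0 < a → Integrable fun u : ℝ =>
        (Set.Ioi (0 : ℝ)).indicator (fun u => u ^ (a - 1)) u * Real.exp (-(rayPath u).re / 4) := by
      intro a ha
      have h1 := integrableOn_rpow_mul_exp_neg_mul_rpow (p := 1) (s := a - 1) (b := 1 / 4)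
        (by linarith) one_pos (by norm_num)
      refine (h1.integrable_indicator measurableSet_Ioi).congr (ae_of_all _ fun u => ?_)
      by_cases hu : u ∈ Set.Ioi (0 : ℝ)
      · have hu' : 0 < u := hu
        simp only [Set.indicator_of_mem hu, rayPath, max_eq_left hu'.le, Complex.ofReal_re,
          Real.rpow_one]
        ring_nf
      · simp [Set.indicator_of_notMem hu]
    -- The smaller exponent dominates for `u ≤ 1` and is still above -1; the larger one dominates
    -- for `u ≥ 1`.
    refine ⟨{q | s.re / 2 < q.re ∧ q.re < s.re + 1}, ?_, fun u =>
      (Set.Ioi (0 : ℝ)).indicator (fun u => u ^ (s.re / 2 - 1)) u +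
        (Set.Ioi (0 : ℝ)).indicator (fun u => u ^ (s.re + 1 - 1)) u, fun q hq u => ?_, ?_⟩
    · refine IsOpen.mem_nhds ?_ ⟨by linarith, by linarith⟩
      exact (isOpen_lt continuous_const Complex.continuous_re).and
        (isOpen_lt Complex.continuous_re continuous_const)
    · by_cases hu : u ∈ Set.Ioi (0 : ℝ)
      · have hu' : 0 < u := hu
        simp only [rayWeight, Set.indicator_of_mem hu]
        rw [norm_exp_mul_log hu', Complex.sub_re, Complex.one_re]
        obtain ⟨h1, h2⟩ := hq
        have ha := Real.rpow_pos_of_pos hu' (s.re / 2 - 1)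
        have hb := Real.rpow_pos_of_pos hu' (s.re + 1 - 1)
        rcases le_total u 1 with h | h
        · have := Real.rpow_le_rpow_of_exponent_ge hu' h
            (by linarith : s.re / 2 - 1 ≤ q.re - 1)
          linarith
        · have := Real.rpow_le_rpow_of_exponent_le h
            (by linarith : q.re - 1 ≤ s.re + 1 - 1)
          linarith
      · simp [rayWeight, Set.indicator_of_notMem hu]
    · simp only [add_mul]
      exact (hint _ (by linarith)).add (hint _ (by linarith))

/-! ### The Hankel contour -/

section Hankel

variable {ε u : ℝ}

theorem hankelAbs_of_neg (hu : u ≤ 0) : hankelAbs ε u = ε - u := by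
  have h := Real.pi_pos
  rw [hankelAbs, max_eq_left (by linarith), max_eq_right (by linarith)]; ring

theorem hankelAbs_of_mem (hu : u ∈ Set.Icc 0 (2 * Real.pi)) : hankelAbs ε u = ε := by
  rw [hankelAbs, max_eq_right (by linarith [hu.1]), max_eq_right (by linarith [hu.2])]; ring

theorem hankelAbs_of_gt (hu : 2 * Real.pi ≤ u) : hankelAbs ε u = ε + u - 2 * Real.pi := by
  have h := Real.pi_pos
  rw [hankelAbs, max_eq_right (by linarith), max_eq_left (by linarith)]; ring

theorem hankelArg_of_neg (hu : u ≤ 0) : hankelArg u = 0 :=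
  max_eq_left ((min_le_left _ _).trans hu)

theorem hankelArg_of_mem (hu : u ∈ Set.Icc 0 (2 * Real.pi)) : hankelArg u = u := by
  rw [hankelArg, min_eq_left hu.2, max_eq_right hu.1]

theorem hankelArg_of_gt (hu : 2 * Real.pi ≤ u) : hankelArg u = 2 * Real.pi := by
  rw [hankelArg, min_eq_right hu, max_eq_right Real.two_pi_pos.le]

theorem hankel_of_neg (hu : u ≤ 0) : hankel ε u = ((ε - u : ℝ) : ℂ) := by
  rw [hankel, hankelAbs_of_neg hu, hankelArg_of_neg hu]; simp

theorem hankel_of_mem (hu : u ∈ Set.Icc 0 (2 * Real.pi)) :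
    hankel ε u = ε * Complex.exp (u * Complex.I) := by
  rw [hankel, hankelAbs_of_mem hu, hankelArg_of_mem hu]

theorem hankel_of_gt (hu : 2 * Real.pi ≤ u) :
    hankel ε u = ((ε + u - 2 * Real.pi : ℝ) : ℂ) := by
  rw [hankel, hankelAbs_of_gt hu, hankelArg_of_gt hu]
  have : Complex.exp (((2 * Real.pi : ℝ) : ℂ) * Complex.I) = 1 := by
    push_cast; exact Complex.exp_two_pi_mul_I
  rw [this, mul_one]

theorem deriv_hankel_of_neg (hu : u < 0) : deriv (hankel ε) u = -1 := by
  have he : hankel ε =ᶠ[𝓝 u] fun u => ((ε - u : ℝ) : ℂ) := by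
    filter_upwards [gt_mem_nhds hu] with v hv using hankel_of_neg hv.le
  rw [he.deriv_eq]
  have : HasDerivAt (fun u : ℝ => ((ε - u : ℝ) : ℂ)) (((-1 : ℝ)) : ℂ) u :=
    ((hasDerivAt_id u).const_sub ε).ofReal_comp
  rw [this.deriv]; simp

theorem deriv_hankel_of_gt (hu : 2 * Real.pi < u) : deriv (hankel ε) u = 1 := by
  have he : hankel ε =ᶠ[𝓝 u] fun u => ((ε + u - 2 * Real.pi : ℝ) : ℂ) := by
    filter_upwards [lt_mem_nhds hu] with v hv using hankel_of_gt hv.le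
  rw [he.deriv_eq]
  have : HasDerivAt (fun u : ℝ => ((ε + u - 2 * Real.pi : ℝ) : ℂ)) (((1 : ℝ)) : ℂ) u :=
    (((hasDerivAt_id u).const_add ε).sub_const _).ofReal_comp
  rw [this.deriv]; simp

theorem deriv_hankel_of_mem (hu : u ∈ Set.Ioo 0 (2 * Real.pi)) :
    deriv (hankel ε) u = Complex.I * (ε * Complex.exp (u * Complex.I)) := by
  have he : hankel ε =ᶠ[𝓝 u] fun u => (ε : ℂ) * Complex.exp (u * Complex.I) := by
    filter_upwards [Ioo_mem_nhds hu.1 hu.2] with v hv using hankel_of_mem ⟨hv.1.le, hv.2.le⟩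
  rw [he.deriv_eq]
  have h1 : HasDerivAt (fun u : ℝ => (u : ℂ) * Complex.I) Complex.I u := by
    simpa using (Complex.ofRealCLM.hasDerivAt (x := u)).mul_const Complex.I
  rw [(h1.cexp.const_mul (ε : ℂ)).deriv]
  ring

theorem continuous_hankelAbs (ε : ℝ) : Continuous (hankelAbs ε) := by
  unfold hankelAbs; fun_prop

theorem continuous_hankelArg : Continuous hankelArg := by
  unfold hankelArg; fun_prop

theorem continuous_hankel (ε : ℝ) : Continuous (hankel ε) := by
  have := continuous_hankelAbs ε
  have := continuous_hankelArg
  unfold hankel; fun_prop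

theorem hankelArg_mem (u : ℝ) : hankelArg u ∈ Set.Icc 0 (2 * Real.pi) :=
  ⟨le_max_left _ _, max_le Real.two_pi_pos.le (min_le_right _ _)⟩

theorem hankel_cases (hε : 0 ≤ ε) (u : ℝ) :
    -ε ≤ (hankel ε u).re ∧ |(hankel ε u).im| ≤ ε := by
  rcases le_total u 0 with h | h
  · rw [hankel_of_neg h, Complex.ofReal_re, Complex.ofReal_im, abs_zero]
    exact ⟨by linarith, hε⟩
  rcases le_total u (2 * Real.pi) with h' | h'
  · rw [hankel_of_mem ⟨h, h'⟩]
    have hn : ‖(ε : ℂ) * Complex.exp (u * Complex.I)‖ = ε := by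
      rw [norm_mul, Complex.norm_exp_ofReal_mul_I, mul_one, Complex.norm_of_nonneg hε]
    constructor
    · have := (abs_le.1 (Complex.abs_re_le_norm ((ε : ℂ) * Complex.exp (u * Complex.I)))).1
      linarith
    · exact (Complex.abs_im_le_norm _).trans hn.le
  · rw [hankel_of_gt h', Complex.ofReal_re, Complex.ofReal_im, abs_zero]
    exact ⟨by linarith, hε⟩

/-- The pullback of `t ^ (s - 1) dt` to the parameter line of the Hankel contour. -/
def hankelWeight (ε : ℝ) (s : ℂ) (u : ℝ) : ℂ := hankelPow ε u (s - 1) * deriv (hankel ε) u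

theorem measurable_hankelPow (ε : ℝ) (a : ℂ) : Measurable fun u => hankelPow ε u a := by
  have := (continuous_hankelAbs ε).measurable
  have := continuous_hankelArg.measurable
  have := Real.measurable_log
  unfold hankelPow
  fun_prop

theorem measurable_hankelWeight (ε : ℝ) (s : ℂ) : Measurable (hankelWeight ε s) :=
  (measurable_hankelPow ε _).mul (measurable_deriv _)

theorem integral_comp_sub_left_Iio {E : Type*} [NormedAddCommGroup E] [NormedSpace ℝ E]
    (f : ℝ → E) (ε : ℝ) : ∫ u in Set.Iio 0, f (ε - u) = ∫ x in Set.Ioi ε, f x := by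
  have h := (Measure.measurePreserving_sub_left volume ε).setIntegral_preimage_emb
    (MeasurableEquiv.subLeft ε).measurableEmbedding f (Set.Ioi ε)
  rw [← h]
  congr 2
  ext u; simp

theorem integrableOn_comp_sub_left_Iio {E : Type*} [NormedAddCommGroup E]
    {f : ℝ → E} {ε : ℝ} (h : IntegrableOn f (Set.Ioi ε)) :
    IntegrableOn (fun u => f (ε - u)) (Set.Iio 0) := by
  have h' := ((Measure.measurePreserving_sub_left volume ε).integrableOn_comp_preimage
    (MeasurableEquiv.subLeft ε).measurableEmbedding (f := f) (s := Set.Ioi ε)).2 h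
  refine h'.congr_set_ae (Eq.eventuallyEq ?_)
  ext u; simp

theorem integral_comp_add_Ioi {E : Type*} [NormedAddCommGroup E] [NormedSpace ℝ E]
    (f : ℝ → E) (ε a : ℝ) : ∫ u in Set.Ioi a, f (ε + u - a) = ∫ x in Set.Ioi ε, f x := by
  have h := (measurePreserving_add_right volume (ε - a)).setIntegral_preimage_emb
    (MeasurableEquiv.addRight (ε - a)).measurableEmbedding f (Set.Ioi ε)
  rw [← h]
  have h1 : ∀ u : ℝ, ε + u - a = u + (ε - a) := fun u => by ring
  simp only [h1]
  congr 2
  ext u; simp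

theorem integrableOn_comp_add_Ioi {E : Type*} [NormedAddCommGroup E] {f : ℝ → E} {ε a : ℝ} :
    IntegrableOn (fun u => f (ε + u - a)) (Set.Ioi a) ↔ IntegrableOn f (Set.Ioi ε) := by
  have h := (measurePreserving_add_right volume (ε - a)).integrableOn_comp_preimage
    (MeasurableEquiv.addRight (ε - a)).measurableEmbedding (f := f) (s := Set.Ioi ε)
  have h1 : ∀ u : ℝ, ε + u - a = u + (ε - a) := fun u => by ring
  have h2 : (fun u => u + (ε - a)) ⁻¹' Set.Ioi ε = Set.Ioi a := by
    ext u; simp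
  rw [h2] at h
  simpa only [h1] using! h

/-- For `x ≥ 1` the first factor is `x ^ A`, absorbed by half of the exponential decay; hence the
rate 1/8. -/
theorem integrableOn_exp_abs_log (hε : 0 < ε) (A : ℝ) :
    IntegrableOn (fun x : ℝ => Real.exp (A * |Real.log x|) * Real.exp (-x / 4)) (Set.Ioi ε) := by
  refine integrable_of_isBigO_exp_neg (b := 1 / 8) (by norm_num) ?_ ?_
  · have : ContinuousOn Real.log (Set.Ici ε) :=
      Real.continuousOn_log.mono fun x hx => (hε.trans_le hx).ne'
    fun_prop
  · have h1 := (isLittleO_rpow_exp_pos_mul_atTop A (b := 1 / 8) (by norm_num)).isBigO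
    have h2 := h1.mul (Asymptotics.isBigO_refl (fun x : ℝ => Real.exp (-x / 4)) atTop)
    refine (h2.congr' ?_ ?_)
    · filter_upwards [eventually_ge_atTop 1] with x hx
      rw [abs_of_nonneg (Real.log_nonneg hx), Real.rpow_def_of_pos (by linarith), mul_comm A]
    · refine Eventually.of_forall fun x => ?_
      simp only [← Real.exp_add]
      ring_nf

theorem integrable_split {E : Type*} [NormedAddCommGroup E] {f : ℝ → E} {b : ℝ} (hb : 0 ≤ b)
    (h1 : IntegrableOn f (Set.Iio 0)) (h2 : IntegrableOn f (Set.Icc 0 b))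
    (h3 : IntegrableOn f (Set.Ioi b)) : Integrable f := by
  rw [← integrableOn_univ]
  have : (Set.univ : Set ℝ) = Set.Iio 0 ∪ Set.Icc 0 b ∪ Set.Ioi b := by
    rw [Set.Iio_union_Icc_eq_Iic hb, Set.Iic_union_Ioi]
  rw [this]
  exact (h1.union h2).union h3

theorem integrable_hankel_majorant (hε : 0 < ε) (A : ℝ) :
    Integrable fun u => Real.exp (A * |Real.log (hankelAbs ε u)|) * ‖deriv (hankel ε) u‖ *
      Real.exp (-(hankel ε u).re / 4) := by
  refine integrable_split Real.two_pi_pos.le ?_ ?_ ?_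
  · refine (integrableOn_comp_sub_left_Iio (integrableOn_exp_abs_log hε A)).congr_fun
      (fun u hu => ?_) measurableSet_Iio
    simp [hankelAbs_of_neg (le_of_lt hu), deriv_hankel_of_neg hu, hankel_of_neg (le_of_lt hu)]
  -- The corners of the contour at `0` and `2π` are dropped: the formula for the derivative holds on
  -- the open arc.
  · rw [integrableOn_Icc_iff_integrableOn_Ioo]
    refine IntegrableOn.congr_fun (f := fun u : ℝ => Real.exp (A * |Real.log ε|) * ε *
      Real.exp (-((ε : ℂ) * Complex.exp (u * Complex.I)).re / 4)) ?_ (fun u hu => ?_)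
      measurableSet_Ioo
    · refine (Continuous.integrableOn_Icc ?_).mono_set Set.Ioo_subset_Icc_self
      fun_prop
    · have hu' : u ∈ Set.Icc 0 (2 * Real.pi) := ⟨hu.1.le, hu.2.le⟩
      simp only [hankelAbs_of_mem hu', deriv_hankel_of_mem hu, hankel_of_mem hu', norm_mul,
        Complex.norm_I, Complex.norm_exp_ofReal_mul_I, Complex.norm_of_nonneg hε.le]
      ring
  · refine (integrableOn_comp_add_Ioi.2 (integrableOn_exp_abs_log hε A)).congr_fun
      (fun u hu => ?_) measurableSet_Ioi
    have hu' : 2 * Real.pi < u := hu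
    simp [hankelAbs_of_gt hu'.le, deriv_hankel_of_gt hu', hankel_of_gt hu'.le]

/-- The argument stays in `[0, 2π]`, so its contribution is at most `e ^ (2πA)`, uniformly for `s`
in a ball. -/
theorem norm_hankelWeight_le {s : ℂ} {A : ℝ} (hs : ‖s - 1‖ ≤ A) (u : ℝ) :
    ‖hankelWeight ε s u‖ ≤ Real.exp (2 * Real.pi * A) *
      (Real.exp (A * |Real.log (hankelAbs ε u)|) * ‖deriv (hankel ε) u‖) := by
  rw [hankelWeight, norm_mul, ← mul_assoc, hankelPow, Complex.norm_exp, ← Real.exp_add]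
  gcongr
  have h1 : ((s - 1) * ((Real.log (hankelAbs ε u) : ℂ) + hankelArg u * Complex.I)).re =
      (s - 1).re * Real.log (hankelAbs ε u) - (s - 1).im * hankelArg u := by
    simp [Complex.mul_re]
  rw [h1]
  have h2 : (s - 1).re * Real.log (hankelAbs ε u) ≤ A * |Real.log (hankelAbs ε u)| := by
    refine (le_abs_self _).trans ?_
    rw [abs_mul]
    gcongr
    exact (Complex.abs_re_le_norm _).trans hs
  have h3 : -((s - 1).im * hankelArg u) ≤ A * (2 * Real.pi) := by
    refine (neg_le_abs _).trans ?_
    obtain ⟨h4, h5⟩ := hankelArg_mem u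
    rw [abs_mul, abs_of_nonneg h4]
    have := (Complex.abs_im_le_norm (s - 1)).trans hs
    exact mul_le_mul this h5 h4 ((abs_nonneg _).trans this)
  linarith

theorem isContourFamily_hankel {δ : ℝ} (hε : 0 < ε) (hδ : ε ≤ δ) :
    IsContourFamily δ (hankel ε) (hankelWeight ε) Set.univ where
  measurable_path := (continuous_hankel ε).measurable
  measurable_weight := measurable_hankelWeight ε
  le_re u := by linarith [(hankel_cases hε.le u).1]
  abs_im_le u := (hankel_cases hε.le u).2.trans hδ
  differentiableOn u := by
    unfold hankelWeight hankelPow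
    fun_prop
  dominated s _ := by
    refine ⟨_, Metric.ball_mem_nhds s one_pos, _,
      fun q hq u => norm_hankelWeight_le (A := ‖s - 1‖ + 1) ?_ u, ?_⟩
    · rw [Metric.mem_ball, dist_eq_norm] at hq
      have : q - 1 = (s - 1) + (q - s) := by ring
      rw [this]
      exact (norm_add_le _ _).trans (by linarith)
    · simpa only [mul_assoc] using
        (integrable_hankel_majorant hε (‖s - 1‖ + 1)).const_mul
          (Real.exp (2 * Real.pi * (‖s - 1‖ + 1)))

end Hankel

/-! ### Deforming the Hankel contour by Cauchy's theorem. -/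

/-- The differential form `F t * t ^ (s - 1) dt` in the coordinate `w = log t`. -/
def logForm (F : ℂ → ℂ) (s w : ℂ) : ℂ := F (Complex.exp w) * Complex.exp (s * w)

theorem logForm_add_two_pi (F : ℂ → ℂ) (s w : ℂ) :
    logForm F s (w + 2 * Real.pi * Complex.I) =
      Complex.exp (2 * Real.pi * Complex.I * s) * logForm F s w := by
  have h1 : Complex.exp (w + 2 * Real.pi * Complex.I) = Complex.exp w := Complex.exp_periodic w
  have h2 : s * (w + 2 * Real.pi * Complex.I) = 2 * Real.pi * Complex.I * s + s * w := by ring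
  rw [logForm, h1, h2, Complex.exp_add, logForm]
  ring

/-- The incoming ray contributes minus the half-line integral; the outgoing one contributes `e ^
(2πis)` times it, because `e ^ (2πi(s - 1)) = e ^ (2πis)`. -/
theorem integral_hankel {ε : ℝ} (hε : 0 < ε) (F : ℂ → ℂ) (s : ℂ)
    (hint : Integrable fun u => F (hankel ε u) * hankelWeight ε s u) :
    ∫ u, F (hankel ε u) * hankelWeight ε s u =
      Complex.I * (∫ θ in (0 : ℝ)..2 * Real.pi, logForm F s (Real.log ε + θ * Complex.I)) +
      (Complex.exp (2 * Real.pi * Complex.I * s) - 1) *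
        ∫ x in Set.Ioi ε, F (x : ℂ) * Complex.exp ((s - 1) * Real.log x) := by
  have h2π := Real.two_pi_pos
  have hsplit : ∫ u, F (hankel ε u) * hankelWeight ε s u =
      (∫ u in Set.Iio 0, F (hankel ε u) * hankelWeight ε s u) +
      ((∫ u in Set.Ico 0 (2 * Real.pi), F (hankel ε u) * hankelWeight ε s u) +
      ∫ u in Set.Ici (2 * Real.pi), F (hankel ε u) * hankelWeight ε s u) := by
    rw [← setIntegral_union _ measurableSet_Ici hint.integrableOn hint.integrableOn,
      Set.Ico_union_Ici_eq_Ici h2π.le, ← Set.compl_Iio, integral_add_compl measurableSet_Iio hint]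
    exact Set.disjoint_left.2 fun x hx hx' => absurd hx.2 (not_lt.2 hx')
  have h1 : (∫ u in Set.Iio 0, F (hankel ε u) * hankelWeight ε s u) =
      -∫ x in Set.Ioi ε, F (x : ℂ) * Complex.exp ((s - 1) * Real.log x) := by
    rw [← integral_comp_sub_left_Iio, ← integral_neg]
    refine setIntegral_congr_fun measurableSet_Iio fun u hu => ?_
    have hu' : u ≤ 0 := le_of_lt hu
    simp only [hankelWeight, hankelPow, hankel_of_neg hu', hankelAbs_of_neg hu',
      hankelArg_of_neg hu', deriv_hankel_of_neg hu]
    push_cast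
    ring_nf
  have h3 : (∫ u in Set.Ici (2 * Real.pi), F (hankel ε u) * hankelWeight ε s u) =
      Complex.exp (2 * Real.pi * Complex.I * s) *
        ∫ x in Set.Ioi ε, F (x : ℂ) * Complex.exp ((s - 1) * Real.log x) := by
    rw [integral_Ici_eq_integral_Ioi, ← integral_comp_add_Ioi _ ε (2 * Real.pi),
      ← integral_const_mul]
    refine setIntegral_congr_fun measurableSet_Ioi fun u hu => ?_
    have hu1 : 2 * Real.pi < u := hu
    have hu' : 2 * Real.pi ≤ u := hu1.le
    simp only [hankelWeight, hankelPow, hankel_of_gt hu', hankelAbs_of_gt hu',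
      hankelArg_of_gt hu', deriv_hankel_of_gt hu1]
    have he : Complex.exp ((s - 1) * ((Real.log (ε + u - 2 * Real.pi) : ℂ) +
        ((2 * Real.pi : ℝ) : ℂ) * Complex.I)) = Complex.exp (2 * Real.pi * Complex.I * s) *
        Complex.exp ((s - 1) * (Real.log (ε + u - 2 * Real.pi) : ℂ)) := by
      have h4 : (s - 1) * ((Real.log (ε + u - 2 * Real.pi) : ℂ) +
        ((2 * Real.pi : ℝ) : ℂ) * Complex.I) = 2 * Real.pi * Complex.I * s +
        (s - 1) * (Real.log (ε + u - 2 * Real.pi) : ℂ) - 2 * Real.pi * Complex.I := by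
        push_cast; ring
      rw [h4, Complex.exp_sub, Complex.exp_two_pi_mul_I, Complex.exp_add, div_one]
    rw [he]
    ring
  have h2 : (∫ u in Set.Ico 0 (2 * Real.pi), F (hankel ε u) * hankelWeight ε s u) =
      Complex.I * (∫ θ in (0 : ℝ)..2 * Real.pi, logForm F s (Real.log ε + θ * Complex.I)) := by
    rw [intervalIntegral.integral_of_le h2π.le, integral_Ico_eq_integral_Ioo,
      integral_Ioc_eq_integral_Ioo, ← integral_const_mul]
    refine setIntegral_congr_fun measurableSet_Ioo fun u hu => ?_
    have hu' : u ∈ Set.Icc 0 (2 * Real.pi) := ⟨hu.1.le, hu.2.le⟩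
    simp only [hankelWeight, hankelPow, hankel_of_mem hu', hankelAbs_of_mem hu',
      hankelArg_of_mem hu', deriv_hankel_of_mem hu, logForm]
    have he : (ε : ℂ) * Complex.exp (u * Complex.I) =
        Complex.exp ((Real.log ε : ℂ) + u * Complex.I) := by
      rw [Complex.exp_add, ← Complex.ofReal_exp, Real.exp_log hε]
    have hs : Complex.exp (s * ((Real.log ε : ℂ) + u * Complex.I)) =
        Complex.exp ((s - 1) * ((Real.log ε : ℂ) + u * Complex.I)) *
        Complex.exp ((Real.log ε : ℂ) + u * Complex.I) := by
      rw [← Complex.exp_add]; ring_nf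
    rw [he, hs]
    ring
  rw [hsplit, h1, h2, h3]
  ring

/-- In the coordinate `log t` the slit annulus is a rectangle of height `2π`. Its horizontal sides
differ by the monodromy factor of `logForm_add_two_pi`, and the boundary integral vanishes. -/
theorem integral_circle_sub {a b : ℝ} (hab : a ≤ b) {F : ℂ → ℂ} (s : ℂ)
    (hF : DifferentiableOn ℂ F (Metric.closedBall 0 (Real.exp b))) :
    Complex.I * (∫ θ in (0 : ℝ)..2 * Real.pi, logForm F s (b + θ * Complex.I)) -
      Complex.I * (∫ θ in (0 : ℝ)..2 * Real.pi, logForm F s (a + θ * Complex.I)) =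
      (Complex.exp (2 * Real.pi * Complex.I * s) - 1) * ∫ x in a..b, logForm F s x := by
  have h := Complex.integral_boundary_rect_eq_zero_of_differentiableOn (logForm F s) (a : ℂ)
    ((b : ℂ) + 2 * Real.pi * Complex.I) ?_
  · have e1 : ((b : ℂ) + 2 * Real.pi * Complex.I).re = b := by simp
    have e2 : ((b : ℂ) + 2 * Real.pi * Complex.I).im = 2 * Real.pi := by simp
    simp only [e1, e2, Complex.ofReal_re, Complex.ofReal_im, Complex.ofReal_zero, zero_mul,
      add_zero, smul_eq_mul, Complex.ofReal_mul, Complex.ofReal_ofNat, logForm_add_two_pi,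
      intervalIntegral.integral_const_mul] at h
    linear_combination h
  · refine DifferentiableOn.mul (hF.comp Complex.differentiable_exp.differentiableOn ?_)
      (by fun_prop)
    intro w hw
    have hw1 : w.re ≤ b := by
      have := hw.1
      simp only [Set.mem_preimage, Complex.ofReal_re, Complex.add_re, Complex.mul_re] at this
      simpa [Set.uIcc_of_le hab, hab] using this.2
    rw [mem_closedBall_zero_iff, Complex.norm_exp]
    exact Real.exp_le_exp.2 hw1

theorem integral_logForm_real {a b : ℝ} {F : ℂ → ℂ} (s : ℂ)
    (hF : ContinuousOn (fun x : ℝ => F x) (Set.Ioi 0)) :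
    ∫ x in a..b, logForm F s x =
      ∫ x in Real.exp a..Real.exp b, F (x : ℂ) * Complex.exp ((s - 1) * Real.log x) := by
  have h := intervalIntegral.integral_deriv_smul_comp'' (f := Real.exp) (f' := Real.exp) (a := a)
    (b := b) (g := fun x : ℝ => F (x : ℂ) * Complex.exp ((s - 1) * Real.log x))
    Real.continuous_exp.continuousOn (fun x _ => (Real.hasDerivAt_exp x).hasDerivWithinAt)
    Real.continuous_exp.continuousOn ?_
  · rw [← h]
    refine intervalIntegral.integral_congr fun x _ => ?_
    simp only [logForm, Function.comp_apply, Real.log_exp, Complex.real_smul, Complex.ofReal_exp]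
    have : s * x = x + (s - 1) * x := by ring
    rw [this, Complex.exp_add]
    ring
  · have hsub : Real.exp '' Set.uIcc a b ⊆ Set.Ioi 0 := by
      rintro _ ⟨x, _, rfl⟩
      exact Real.exp_pos x
    refine ContinuousOn.mul (hF.mono hsub) ?_
    have : ContinuousOn Real.log (Real.exp '' Set.uIcc a b) :=
      Real.continuousOn_log.mono fun x hx => (hsub hx).ne'
    fun_prop

theorem integrableOn_Ioi_of_hankel {ε : ℝ} {F : ℂ → ℂ} {s : ℂ}
    (hint : Integrable fun u => F (hankel ε u) * hankelWeight ε s u) :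
    IntegrableOn (fun x : ℝ => F (x : ℂ) * Complex.exp ((s - 1) * Real.log x)) (Set.Ioi ε) := by
  rw [← integrableOn_comp_add_Ioi (a := 2 * Real.pi)]
  refine IntegrableOn.congr_fun
    (hint.const_mul (Complex.exp (-(2 * Real.pi * Complex.I * s)))).integrableOn
    (fun u hu => ?_) measurableSet_Ioi
  have hu1 : 2 * Real.pi < u := hu
  have hu' : 2 * Real.pi ≤ u := hu1.le
  simp only [hankelWeight, hankelPow, hankel_of_gt hu', hankelAbs_of_gt hu',
    hankelArg_of_gt hu', deriv_hankel_of_gt hu1]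
  have he : Complex.exp ((s - 1) * (Real.log (ε + u - 2 * Real.pi) : ℂ)) =
      Complex.exp (-(2 * Real.pi * Complex.I * s)) *
      Complex.exp ((s - 1) * ((Real.log (ε + u - 2 * Real.pi) : ℂ) +
        ((2 * Real.pi : ℝ) : ℂ) * Complex.I)) := by
    have h4 : (s - 1) * ((Real.log (ε + u - 2 * Real.pi) : ℂ) +
      ((2 * Real.pi : ℝ) : ℂ) * Complex.I) = 2 * Real.pi * Complex.I * s +
      (s - 1) * (Real.log (ε + u - 2 * Real.pi) : ℂ) - 2 * Real.pi * Complex.I := by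
      push_cast; ring
    rw [h4, Complex.exp_sub, Complex.exp_two_pi_mul_I, div_one, ← Complex.exp_add]
    ring_nf
  rw [he]
  ring

/-- The Hankel integral does not depend on the radius. -/
theorem integral_hankel_eq {ε ε' : ℝ} (hε' : 0 < ε') (h : ε' ≤ ε) {F : ℂ → ℂ} (s : ℂ)
    (hF : DifferentiableOn ℂ F (Metric.closedBall 0 ε))
    (hFc : ContinuousOn (fun x : ℝ => F x) (Set.Ioi 0))
    (hint : Integrable fun u => F (hankel ε u) * hankelWeight ε s u)
    (hint' : Integrable fun u => F (hankel ε' u) * hankelWeight ε' s u) :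
    ∫ u, F (hankel ε u) * hankelWeight ε s u = ∫ u, F (hankel ε' u) * hankelWeight ε' s u := by
  have hε : 0 < ε := hε'.trans_le h
  have h1 := integral_circle_sub (Real.log_le_log hε' h) s (F := F) (by rwa [Real.exp_log hε])
  rw [integral_logForm_real s hFc, Real.exp_log hε, Real.exp_log hε'] at h1
  have h2 := intervalIntegral.integral_interval_add_Ioi (integrableOn_Ioi_of_hankel hint')
    (integrableOn_Ioi_of_hankel hint)
  rw [integral_hankel hε F s hint, integral_hankel hε' F s hint', ← h2]
  linear_combination h1

/-- For exponents with positive real part the Hankel integral reduces to the half-line. -/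
theorem integral_hankel_eq_ray {ε : ℝ} (hε : 0 < ε) {F : ℂ → ℂ} {s : ℂ} (hs : 0 < s.re)
    (hF : DifferentiableOn ℂ F (Metric.closedBall 0 ε))
    (hFc : ContinuousOn (fun x : ℝ => F x) (Set.Ioi 0))
    (hint : ∀ ε' ∈ Set.Ioc 0 ε, Integrable fun u => F (hankel ε' u) * hankelWeight ε' s u)
    (hray : Integrable fun u => F (rayPath u) * rayWeight s u) :
    ∫ u, F (hankel ε u) * hankelWeight ε s u =
      (Complex.exp (2 * Real.pi * Complex.I * s) - 1) * ∫ u, F (rayPath u) * rayWeight s u := by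
  set G : ℝ → ℂ := fun x => F (x : ℂ) * Complex.exp ((s - 1) * Real.log x) with hG
  have hrayG : (fun u => F (rayPath u) * rayWeight s u) = (Set.Ioi 0).indicator G := by
    funext u
    by_cases hu : u ∈ Set.Ioi (0 : ℝ)
    · have hu' : 0 < u := hu
      simp [rayWeight, rayPath, hG, Set.indicator_of_mem hu, max_eq_left hu'.le]
    · simp [rayWeight, Set.indicator_of_notMem hu]
  rw [hrayG] at hray ⊢
  rw [integral_indicator measurableSet_Ioi]
  rw [integrable_indicator_iff measurableSet_Ioi] at hray
  set e : ℕ → ℝ := fun n => ε * (1 / ((n : ℝ) + 1)) with he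
  have he0 : ∀ n, e n ∈ Set.Ioc 0 ε := fun n => by
    have h1 : (0 : ℝ) < 1 / ((n : ℝ) + 1) := by positivity
    have h2 : 1 / ((n : ℝ) + 1) ≤ 1 := by
      rw [div_le_one (by positivity)]
      linarith [n.cast_nonneg (α := ℝ)]
    exact ⟨by positivity, by simp only [he]; nlinarith⟩
  have helim : Tendsto e atTop (𝓝 0) := by
    simpa [he] using (tendsto_one_div_add_atTop_nhds_zero_nat (𝕜 := ℝ)).const_mul ε
  have hanti : Antitone e := fun m n hmn => by
    simp only [he]
    gcongr
  have hU : (⋃ n, Set.Ioi (e n)) = Set.Ioi 0 := by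
    ext x
    simp only [Set.mem_iUnion, Set.mem_Ioi]
    constructor
    · rintro ⟨n, hn⟩
      exact (he0 n).1.trans hn
    · intro hx
      exact (helim.eventually (gt_mem_nhds hx)).exists
  have hT : Tendsto (fun n => ∫ x in Set.Ioi (e n), G x) atTop (𝓝 (∫ x in Set.Ioi 0, G x)) := by
    rw [← hU]
    exact tendsto_setIntegral_of_monotone (fun n => measurableSet_Ioi)
      (fun m n hmn => Set.Ioi_subset_Ioi (hanti hmn)) (by rwa [hU])
  -- The circle of radius `e n` contributes `O(e n ^ Re s)`, which vanishes in the limit because `Re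
  -- s > 0`.
  have hV : Tendsto (fun n => Complex.I * (∫ θ in (0 : ℝ)..2 * Real.pi,
      logForm F s (Real.log (e n) + θ * Complex.I))) atTop (𝓝 0) := by
    obtain ⟨M, hM⟩ := (isCompact_closedBall (0 : ℂ) ε).exists_bound_of_continuousOn hF.continuousOn
    have hlim : Tendsto (fun n => M * (Real.exp (2 * Real.pi * |s.im|) * e n ^ s.re) *
        |2 * Real.pi - 0|) atTop (𝓝 0) := by
      have := (helim.rpow_const (Or.inr hs.le) (p := s.re))
      rw [Real.zero_rpow hs.ne'] at this
      simpa using ((this.const_mul (Real.exp (2 * Real.pi * |s.im|))).const_mul M).mul_const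
        |2 * Real.pi - 0|
    refine squeeze_zero_norm (fun n => ?_) hlim
    rw [norm_mul, Complex.norm_I, one_mul]
    refine intervalIntegral.norm_integral_le_of_norm_le_const fun θ hθ => ?_
    rw [Set.uIoc_of_le Real.two_pi_pos.le] at hθ
    have hen : 0 < e n := (he0 n).1
    have hexp : ‖Complex.exp ((Real.log (e n) : ℂ) + θ * Complex.I)‖ = e n := by
      rw [Complex.norm_exp]
      simp [Real.exp_log hen]
    have hM' := hM (Complex.exp ((Real.log (e n) : ℂ) + θ * Complex.I))
      (by rw [mem_closedBall_zero_iff, hexp]; exact (he0 n).2)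
    rw [logForm, norm_mul]
    have hs2 : ‖Complex.exp (s * ((Real.log (e n) : ℂ) + θ * Complex.I))‖ ≤
        Real.exp (2 * Real.pi * |s.im|) * e n ^ s.re := by
      rw [Complex.norm_exp, Real.rpow_def_of_pos hen, ← Real.exp_add]
      have h1 : (s * ((Real.log (e n) : ℂ) + θ * Complex.I)).re =
          s.re * Real.log (e n) - s.im * θ := by simp [Complex.mul_re]
      rw [h1]
      gcongr
      have h2 : -(s.im * θ) ≤ |s.im| * (2 * Real.pi) := by
        refine (neg_le_abs _).trans ?_
        rw [abs_mul, abs_of_pos hθ.1]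
        gcongr
        exact hθ.2
      linarith
    exact mul_le_mul hM' hs2 (norm_nonneg _) ((norm_nonneg _).trans hM')
  have hconst : ∀ n, ∫ u, F (hankel ε u) * hankelWeight ε s u =
      Complex.I * (∫ θ in (0 : ℝ)..2 * Real.pi, logForm F s (Real.log (e n) + θ * Complex.I)) +
      (Complex.exp (2 * Real.pi * Complex.I * s) - 1) * ∫ x in Set.Ioi (e n), G x := fun n => by
    rw [← integral_hankel (he0 n).1 F s (hint _ (he0 n))]
    exact integral_hankel_eq (he0 n).1 (he0 n).2 s hF hFc (hint ε ⟨hε, le_rfl⟩) (hint _ (he0 n))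
  have hlim := hV.add (hT.const_mul (Complex.exp (2 * Real.pi * Complex.I * s) - 1))
  rw [zero_add] at hlim
  exact tendsto_nhds_unique (tendsto_const_nhds.congr hconst) hlim

/-! ### Normalization, and equivalence of the normalized contours. -/

/-- The coefficient `1 / ((e ^ (2πis) - 1) Γ(s))`, written so that it is holomorphic away from the
positive integers. -/
def hankelCoeff (s : ℂ) : ℂ :=
  Complex.exp (-(Real.pi * Complex.I * s)) * Complex.Gamma (1 - s) / (2 * Real.pi * Complex.I)

theorem differentiableOn_hankelCoeff : DifferentiableOn ℂ hankelCoeff {s | s.re < 1} := by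
  intro s hs
  have hs' : s.re < 1 := hs
  refine DifferentiableAt.differentiableWithinAt ?_
  have hG : DifferentiableAt ℂ (fun s => Complex.Gamma (1 - s)) s := by
    refine DifferentiableAt.comp s (g := Complex.Gamma)
      (Complex.differentiableAt_Gamma _ fun m hm => ?_) (by fun_prop)
    have := congrArg Complex.re hm
    simp only [Complex.sub_re, Complex.one_re, Complex.neg_re, Complex.natCast_re] at this
    linarith [m.cast_nonneg (α := ℝ)]
  unfold hankelCoeff
  fun_prop

theorem exp_sub_one_eq (s : ℂ) : Complex.exp (2 * Real.pi * Complex.I * s) - 1 =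
    2 * Complex.I * Complex.exp (Real.pi * Complex.I * s) * Complex.sin (Real.pi * s) := by
  have h : Complex.exp (2 * Real.pi * Complex.I * s) =
      Complex.exp (Real.pi * Complex.I * s) * Complex.exp (Real.pi * Complex.I * s) := by
    rw [← Complex.exp_add]; ring_nf
  have h1 : Complex.exp (-(Real.pi * s) * Complex.I) * Complex.exp (Real.pi * Complex.I * s) = 1 := by
    rw [← Complex.exp_add, ← Complex.exp_zero]; ring_nf
  have h2 : (Real.pi : ℂ) * s * Complex.I = Real.pi * Complex.I * s := by ring
  rw [h, Complex.sin, h2]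
  linear_combination h1 - (Complex.exp (-(Real.pi * s) * Complex.I) *
    Complex.exp (Real.pi * Complex.I * s) - Complex.exp (Real.pi * Complex.I * s) *
    Complex.exp (Real.pi * Complex.I * s)) * Complex.I_sq

theorem sin_pi_mul_ne_zero {s : ℂ} (hs : ∀ n : ℤ, s ≠ n) : Complex.sin (Real.pi * s) ≠ 0 := by
  rw [Complex.sin_ne_zero_iff]
  intro k hk
  have hπ : (Real.pi : ℂ) ≠ 0 := by exact_mod_cast Real.pi_ne_zero
  exact hs k (mul_left_cancel₀ hπ (by rw [hk]; ring))

/-- The reflection formula for `Γ`. It cancels the factor `e ^ (2πis) - 1` that arises when the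
Hankel contour collapses onto the half-line. -/
theorem hankelCoeff_mul {s : ℂ} (hs : ∀ n : ℤ, s ≠ n) :
    hankelCoeff s * (Complex.exp (2 * Real.pi * Complex.I * s) - 1) = (Complex.Gamma s)⁻¹ := by
  have hsin := sin_pi_mul_ne_zero hs
  have hG : Complex.Gamma s ≠ 0 := Complex.Gamma_ne_zero fun m hm => hs (-m) (by
    rw [hm]; push_cast; rfl)
  have hπ : (Real.pi : ℂ) ≠ 0 := by exact_mod_cast Real.pi_ne_zero
  have hr := Complex.Gamma_mul_Gamma_one_sub s
  rw [eq_div_iff hsin] at hr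
  have h1 : Complex.exp (-(Real.pi * Complex.I * s)) * Complex.exp (Real.pi * Complex.I * s) = 1 := by
    rw [← Complex.exp_add, ← Complex.exp_zero]; ring_nf
  refine eq_inv_of_mul_eq_one_left ?_
  rw [exp_sub_one_eq, hankelCoeff, div_mul_eq_mul_div, div_mul_eq_mul_div,
    div_eq_one_iff_eq (by simp [hπ])]
  linear_combination 2 * Complex.I * Complex.exp (-(Real.pi * Complex.I * s)) *
    Complex.exp (Real.pi * Complex.I * s) * hr + 2 * Complex.I * Real.pi * h1

theorem hankelCoeff_eq {s : ℂ} (hs : ∀ n : ℤ, s ≠ n) :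
    1 / ((Complex.exp (2 * Real.pi * Complex.I * s) - 1) * Complex.Gamma s) = hankelCoeff s := by
  have hsin := sin_pi_mul_ne_zero hs
  have hG : Complex.Gamma s ≠ 0 := Complex.Gamma_ne_zero fun m hm => hs (-m) (by
    rw [hm]; push_cast; rfl)
  have hE : Complex.exp (2 * Real.pi * Complex.I * s) - 1 ≠ 0 := by
    rw [exp_sub_one_eq]
    simp [hsin, Complex.exp_ne_zero]
  rw [div_eq_iff (mul_ne_zero hE hG), ← mul_assoc, hankelCoeff_mul hs, inv_mul_cancel₀ hG]

/-- The normalized weight on the Hankel contour. -/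
def hankelNWeight (ε : ℝ) (s : ℂ) (u : ℝ) : ℂ := hankelCoeff s * hankelWeight ε s u

/-- The normalized weight on the half-line. -/
def rayNWeight (s : ℂ) (u : ℝ) : ℂ := (Complex.Gamma s)⁻¹ * rayWeight s u

theorem isContourFamily_hankelN {ε δ : ℝ} (hε : 0 < ε) (hδ : ε ≤ δ) :
    IsContourFamily δ (hankel ε) (hankelNWeight ε) {s | s.re < 1} :=
  (isContourFamily_hankel hε hδ).mul_left (isOpen_lt Complex.continuous_re continuous_const)
    (Set.subset_univ _) differentiableOn_hankelCoeff

/-- For a single exponent the coefficient is just a constant, so no restriction on `s` is needed. -/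
theorem isContour_hankelN {ε δ : ℝ} (hε : 0 < ε) (hδ : ε ≤ δ) (s : ℂ) :
    IsContour δ (hankel ε) (hankelNWeight ε s) :=
  ((isContourFamily_hankel hε hδ).mul_left (κ := fun _ => hankelCoeff s) isOpen_univ subset_rfl
    (differentiableOn_const _)).isContour (Set.mem_univ s)

theorem isContourFamily_rayN {δ : ℝ} (hδ : 0 ≤ δ) :
    IsContourFamily δ rayPath rayNWeight {s | 0 < s.re} :=
  (isContourFamily_ray hδ).mul_left (isOpen_lt continuous_const Complex.continuous_re) subset_rfl
    Complex.differentiable_one_div_Gamma.differentiableOn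

section

variable {δ ρ : ℝ} {f : ℂ → ℂ} {y : ℂ}

theorem closedBall_translate_mem {ε : ℝ} (h : ε ≤ δ) (hy : y ∈ halfStrip ρ) :
    Set.MapsTo (fun x => y + x) (Metric.closedBall 0 ε) (halfStrip (ρ + δ)) := fun x hx => by
  rw [mem_closedBall_zero_iff] at hx
  refine add_mem_halfStrip hy ?_ ((Complex.abs_im_le_norm x).trans (hx.trans h))
  linarith [(abs_le.1 (Complex.abs_re_le_norm x)).1]

theorem differentiableOn_translate {ε : ℝ} (h : ε ≤ δ)
    (hf : DifferentiableOn ℂ f (halfStrip (ρ + δ))) (hy : y ∈ halfStrip ρ) :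
    DifferentiableOn ℂ (fun x => f (y + x)) (Metric.closedBall 0 ε) :=
  hf.comp (differentiableOn_id.const_add y) (closedBall_translate_mem h hy)

theorem continuousOn_translate (hδ : 0 ≤ δ)
    (hf : DifferentiableOn ℂ f (halfStrip (ρ + δ))) (hy : y ∈ halfStrip ρ) :
    ContinuousOn (fun x : ℝ => f (y + x)) (Set.Ioi 0) := by
  refine hf.continuousOn.comp (by fun_prop) fun x hx => ?_
  have hx' : 0 < x := hx
  exact add_mem_halfStrip hy (by rw [Complex.ofReal_re]; linarith) (by simpa using hδ)

end

theorem contourEquiv_hankel {ε ε' δ : ℝ} (hε : 0 < ε) (hδ : ε ≤ δ) (hε' : 0 < ε') (hδ' : ε' ≤ δ)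
    (s : ℂ) : ContourEquiv δ (hankel ε) (hankelNWeight ε s) (hankel ε') (hankelNWeight ε' s) := by
  wlog h : ε' ≤ ε generalizing ε ε'
  · exact (this hε' hδ' hε hδ (le_of_not_ge h)).symm
  intro ρ f hf hb y hy
  have hint : ∀ η : ℝ, 0 < η → η ≤ δ →
      Integrable fun x => f (y + hankel η x) * hankelWeight η s x := fun η h1 h2 =>
    ((isContourFamily_hankel h1 h2).isContour (Set.mem_univ s)).integrable_mul hf.continuousOn hb hy
  have := integral_hankel_eq hε' h s (differentiableOn_translate hδ hf hy)
    (continuousOn_translate (hε.le.trans hδ) hf hy) (hint ε hε hδ) (hint ε' hε' hδ')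
  simp only [hankelNWeight, mul_left_comm _ (hankelCoeff s), integral_const_mul, this]

theorem contourEquiv_hankel_ray {ε δ : ℝ} (hε : 0 < ε) (hδ : ε ≤ δ) {s : ℂ} (hs : 0 < s.re)
    (hs' : ∀ n : ℤ, s ≠ n) :
    ContourEquiv δ (hankel ε) (hankelNWeight ε s) rayPath (rayNWeight s) := by
  intro ρ f hf hb y hy
  have := integral_hankel_eq_ray hε hs (differentiableOn_translate hδ hf hy)
    (continuousOn_translate (hε.le.trans hδ) hf hy)
    (fun η h => ((isContourFamily_hankel h.1 (h.2.trans hδ)).isContour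
      (Set.mem_univ s)).integrable_mul hf.continuousOn hb hy)
    (((isContourFamily_ray (hε.le.trans hδ)).isContour hs).integrable_mul hf.continuousOn hb hy)
  simp only [hankelNWeight, rayNWeight, mul_left_comm _ (hankelCoeff s),
    mul_left_comm _ (Complex.Gamma s)⁻¹, integral_const_mul, this]
  rw [← mul_assoc, hankelCoeff_mul hs']

theorem ContourEquiv.refl (δ : ℝ) (p w : ℝ → ℂ) : ContourEquiv δ p w p w :=
  fun _ _ _ _ _ _ => rfl

/-- Joint holomorphy in all exponents: on a product neighbourhood the product of the one-variable
bounds dominates the integrand. -/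
theorem differentiableAt_iterInt_weight {r : ℕ} {g : ℂ → ℂ} {p : Fin r → ℝ → ℂ}
    {w : Fin r → ℂ → ℝ → ℂ} {D : Fin r → Set ℂ} {δ ρ C : ℝ} {y : ℂ} {s : Fin r → ℂ}
    (hδ : 0 ≤ δ) (hρ : ρ + r * δ ≤ 1) (hC : 0 ≤ C) (hg : Measurable g)
    (hb : ∀ z ∈ halfStrip 1, ‖g z‖ ≤ C * Real.exp (-z.re / 4))
    (hpw : ∀ k, IsContourFamily δ (p k) (w k) (D k)) (hD : ∀ k, IsOpen (D k)) (hs : ∀ k, s k ∈ D k)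
    (hy : y ∈ halfStrip ρ) :
    DifferentiableAt ℂ (fun s => iterInt r g p (fun k => w k (s k)) y) s := by
  choose V hV B hB hint using fun k => (hpw k).dominated (s k) (hs k)
  have hB' : ∀ k u, 0 ≤ B k u := fun k u =>
    (norm_nonneg _).trans (hB k (s k) (mem_of_mem_nhds (hV k)) u)
  have hVD : (Set.univ.pi fun k => V k ∩ D k) ∈ 𝓝 s :=
    set_pi_mem_nhds Set.finite_univ fun k _ => inter_mem (hV k) ((hD k).mem_nhds (hs k))
  refine differentiableAt_integral hVD (fun q _ => (measurable_iterIntegrand hg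
    (fun k => (hpw k).measurable_path) (fun k => (hpw k).measurable_weight _)
    y).aestronglyMeasurable) (fun u => ?_) (bound := fun u =>
      ∏ k, (C * Real.exp (1 / 4)) * (B k (u k) * Real.exp (-(p k (u k)).re / 4)))
    (fun u q hq => ?_) ?_
  · unfold iterIntegrand
    refine DifferentiableOn.mul (differentiableOn_const _) fun q hq => ?_
    refine (HasFDerivWithinAt.finsetProd (g := fun k (q : Fin r → ℂ) => w k (q k) (u k))
      fun k _ => DifferentiableWithinAt.hasFDerivWithinAt ?_).differentiableWithinAt
    have hk : DifferentiableOn ℂ (fun q : Fin r → ℂ => w k (q k) (u k))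
        (Set.univ.pi fun k => V k ∩ D k) :=
      ((hpw k).differentiableOn (u k)).comp
        (differentiable_apply (𝕜 := ℂ) k).differentiableOn fun q hq => (hq k (Set.mem_univ k)).2
    exact hk q hq
  · refine (norm_iterIntegrand_le hδ hρ hC hb (fun k => (hpw k).le_re) (fun k => (hpw k).abs_im_le)
      hy u).trans (Finset.prod_le_prod (fun k _ => by positivity) fun k _ => ?_)
    have := hB k (q k) (hq k (Set.mem_univ k)).1 (u k)
    gcongr
  · exact Integrable.fintype_prod
      (f := fun k x => (C * Real.exp (1 / 4)) * (B k x * Real.exp (-(p k x).re / 4)))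
      fun k => (hint k).const_mul _

/-! ### The entire function obtained by gluing the two contours. -/

/-- The bound on the radii of the Hankel contours in depth `r`. -/
def depthRadius (r : ℕ) : ℝ := 1 / (r + 1)

theorem depthRadius_pos (r : ℕ) : 0 < depthRadius r := by unfold depthRadius; positivity

theorem depthRadius_add (r : ℕ) : depthRadius r + r * depthRadius r ≤ 1 := by
  have : depthRadius r + r * depthRadius r = 1 := by unfold depthRadius; field_simp; ring
  exact this.le

theorem zero_mem_halfStrip {ρ : ℝ} (hρ : 0 < ρ) : (0 : ℂ) ∈ halfStrip ρ :=
  ⟨by simpa using hρ, by simpa using hρ⟩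

/-- The half-line or the Hankel contour. -/
def mixPath (δ : ℝ) (A : Bool) : ℝ → ℂ := if A then rayPath else hankel δ

/-- The normalized weight on `mixPath`. -/
def mixWeight (δ : ℝ) (A : Bool) : ℂ → ℝ → ℂ := if A then rayNWeight else hankelNWeight δ

/-- A half-plane of exponents on which `mixWeight` is holomorphic. -/
def mixDomain (A : Bool) : Set ℂ := if A then {s | 0 < s.re} else {s | s.re < 1}

theorem isOpen_mixDomain (A : Bool) : IsOpen (mixDomain A) := by
  cases A
  · exact isOpen_lt Complex.continuous_re continuous_const
  · exact isOpen_lt continuous_const Complex.continuous_re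

theorem isContourFamily_mix {δ : ℝ} (hδ : 0 < δ) (A : Bool) :
    IsContourFamily δ (mixPath δ A) (mixWeight δ A) (mixDomain A) := by
  cases A
  · exact isContourFamily_hankelN hδ le_rfl
  · exact isContourFamily_rayN hδ.le

/-- The choice of contour for a given exponent. -/
def mixChoice (s : ℂ) : Bool := decide (1 / 2 < s.re)

theorem mem_mixDomain_mixChoice (s : ℂ) : s ∈ mixDomain (mixChoice s) := by
  by_cases h : 1 / 2 < s.re
  · simp only [mixDomain, mixChoice, h, decide_true, if_true, Set.mem_ofPred_eq]; linarith
  · simp only [mixDomain, mixChoice, h, decide_false, Set.mem_ofPred_eq,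
      Bool.false_eq_true, if_false]
    linarith

/-- The desingularized multiple zeta function, as an iterated integral. -/
def desZetaInt (r : ℕ) (s : Fin r → ℂ) : ℂ :=
  iterInt r desKer (fun k => mixPath (depthRadius r) (mixChoice (s k)))
    (fun k => mixWeight (depthRadius r) (mixChoice (s k)) (s k)) 0

/-- The overlap of the two half-planes of exponents contains no integer, so collapsing the Hankel
contour is legitimate there. -/
theorem contourEquiv_mix {δ : ℝ} (hδ : 0 < δ) {s : ℂ} (hs : 0 < s.re) (hs' : s.re < 1)
    (A A' : Bool) :
    ContourEquiv δ (mixPath δ A) (mixWeight δ A s) (mixPath δ A') (mixWeight δ A' s) := by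
  have hint : ∀ n : ℤ, s ≠ n := by
    rintro n rfl
    rw [Complex.intCast_re] at hs hs'
    norm_cast at hs hs'
    omega
  have h := contourEquiv_hankel_ray hδ le_rfl hs hint
  cases A <;> cases A'
  · exact .refl _ _ _
  · exact h
  · exact h.symm
  · exact .refl _ _ _

/-- The choice jumps only across `Re s = 1/2`, which lies inside the overlap where both contours
agree. -/
theorem eventually_mixChoice (s₀ : ℂ) :
    ∀ᶠ s in 𝓝 s₀, s ∈ mixDomain (mixChoice s₀) ∧
      (mixChoice s = mixChoice s₀ ∨ 0 < s.re ∧ s.re < 1) := by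
  have h0 := (isOpen_mixDomain _).mem_nhds (mem_mixDomain_mixChoice s₀)
  by_cases h : 1 / 2 < s₀.re
  · filter_upwards [h0, Complex.continuous_re.continuousAt.eventually (lt_mem_nhds h)] with s h1 h2
    exact ⟨h1, Or.inl (by simp only [mixChoice, h, h2])⟩
  · have h3 : s₀.re < 1 := by linarith
    filter_upwards [h0, Complex.continuous_re.continuousAt.eventually (gt_mem_nhds h3)] with s h1 h2
    refine ⟨h1, ?_⟩
    by_cases h4 : 1 / 2 < s.re
    · exact Or.inr ⟨by linarith, h2⟩
    · exact Or.inl (by simp only [mixChoice, h, h4])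

theorem exists_norm_desKer_le' :
    ∃ C, 0 ≤ C ∧ ∀ z ∈ halfStrip 1, ‖desKer z‖ ≤ C * Real.exp (-z.re / 4) := by
  obtain ⟨C, hC, hb⟩ := exists_norm_desKer_le
  refine ⟨C * Real.exp 1, by positivity, fun z hz => ?_⟩
  refine (hb z (halfStrip_mono one_le_two hz)).trans ?_
  rw [mul_assoc, ← Real.exp_add]
  gcongr
  linarith [hz.1]

theorem differentiableOn_desKer_halfStrip : DifferentiableOn ℂ desKer (halfStrip 1) :=
  differentiableOn_desKer.mono (halfStrip_subset_strip one_le_two)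

theorem differentiable_desZetaInt (r : ℕ) : Differentiable ℂ (desZetaInt r) := by
  intro s₀
  obtain ⟨C, hC, hb⟩ := exists_norm_desKer_le'
  have hδ := depthRadius_pos r
  have h0 := zero_mem_halfStrip hδ
  -- With the contours frozen at their choice for `s₀`, the integral is holomorphic at `s₀`; it
  -- agrees with `desZetaInt` nearby.
  have hd := differentiableAt_iterInt_weight (s := s₀) hδ.le (depthRadius_add r) hC measurable_desKer
    hb (fun k => isContourFamily_mix hδ (mixChoice (s₀ k))) (fun k => isOpen_mixDomain _)
    (fun k => mem_mixDomain_mixChoice _) h0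
  refine hd.congr_of_eventuallyEq ?_
  have he : ∀ᶠ s : Fin r → ℂ in 𝓝 s₀, ∀ k, s k ∈ mixDomain (mixChoice (s₀ k)) ∧
      (mixChoice (s k) = mixChoice (s₀ k) ∨ 0 < (s k).re ∧ (s k).re < 1) :=
    eventually_all.2 fun k =>
      ((continuous_apply k).tendsto s₀).eventually (eventually_mixChoice (s₀ k))
  filter_upwards [he] with s hs
  refine iterInt_congr hδ.le (depthRadius_add r) hC measurable_desKer
    differentiableOn_desKer_halfStrip hb
    (fun k => (isContourFamily_mix hδ _).isContour (mem_mixDomain_mixChoice _))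
    (fun k => (isContourFamily_mix hδ _).isContour (hs k).1) (fun k => ?_) h0
  rcases (hs k).2 with h | ⟨h1, h2⟩
  · rw [h]; exact .refl _ _ _
  · exact contourEquiv_mix hδ h1 h2 _ _

theorem desZetaInt_eq_hankel {r : ℕ} {ε : ℝ} (hε : 0 < ε) (hε' : ε ≤ depthRadius r)
    {s : Fin r → ℂ} (hs : ∀ (j : Fin r) (n : ℤ), s j ≠ n) :
    desZetaInt r s = iterInt r desKer (fun _ => hankel ε) (fun k => hankelNWeight ε (s k)) 0 := by
  obtain ⟨C, hC, hb⟩ := exists_norm_desKer_le'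
  have hδ := depthRadius_pos r
  refine iterInt_congr hδ.le (depthRadius_add r) hC measurable_desKer
    differentiableOn_desKer_halfStrip hb
    (fun k => (isContourFamily_mix hδ _).isContour (mem_mixDomain_mixChoice _))
    (fun k => isContour_hankelN hε hε' _) (fun k => ?_) (zero_mem_halfStrip hδ)
  by_cases h : 1 / 2 < (s k).re
  · have : mixChoice (s k) = true := by simp only [mixChoice, h, decide_true]
    rw [this]
    exact (contourEquiv_hankel_ray hε hε' (by linarith) (hs k)).symm
  · have : mixChoice (s k) = false := by simp only [mixChoice, h, decide_false]
    rw [this]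
    exact contourEquiv_hankel hδ le_rfl hε hε' _

/-! ### The limit `c → 1` and the identification with `desZeta`. -/

theorem integrand_eq (r : ℕ) (s : Fin r → ℂ) (ε c : ℝ) :
    integrand r s ε c =
      iterIntegrand r (kernel c) (fun _ => hankel ε) (fun k => hankelWeight ε (s k)) 0 := by
  funext u
  simp only [integrand, genFun, iterIntegrand, zero_add, hankelWeight]

theorem preDesZeta_eq {r : ℕ} {s : Fin r → ℂ} (hs : ∀ (j : Fin r) (n : ℤ), s j ≠ n) (ε c : ℝ) :
    preDesZeta r s ε c = iterInt r (fun y => kernel c y / (1 - c)) (fun _ => hankel ε)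
      (fun k => hankelNWeight ε (s k)) 0 := by
  have hcoeff : coeff r s = ∏ k, hankelCoeff (s k) :=
    Finset.prod_congr rfl fun k _ => hankelCoeff_eq (hs k)
  rw [preDesZeta, hcoeff, integrand_eq, ← integral_const_mul, ← integral_const_mul, iterInt]
  congr 1
  funext u
  simp only [iterIntegrand, hankelNWeight, Finset.prod_mul_distrib, Finset.prod_div_distrib,
    Finset.prod_const, Finset.card_univ, Fintype.card_fin]
  ring

theorem isDesZeta_desZetaInt (r : ℕ) : IsDesZeta r (desZetaInt r) := by
  refine ⟨differentiable_desZetaInt r, ?_⟩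
  have hδ := depthRadius_pos r
  have h0 := zero_mem_halfStrip hδ
  filter_upwards [Ioc_mem_nhdsGT hδ] with ε hε s hs
  obtain ⟨C, hC, hb⟩ := exists_norm_kernel_div_le
  have hc : ∀ᶠ c : ℝ in 𝓝[≠] 1, c ∈ Set.Ioo (1 / 2 : ℝ) 2 ∧ c ≠ 1 := by
    filter_upwards [self_mem_nhdsWithin,
      nhdsWithin_le_nhds (Ioo_mem_nhds (by norm_num : (1 / 2 : ℝ) < 1) one_lt_two)] with c h1 h2
    exact ⟨h2, h1⟩
  constructor
  · filter_upwards [hc] with c hc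
    rw [integrand_eq]
    refine integrable_iterIntegrand (C := C * ‖1 - (c : ℂ)‖) hδ.le (depthRadius_add r)
      (by positivity) (measurable_kernel c) (fun z hz => ?_)
      (fun k => (isContourFamily_hankel hε.1 hε.2).isContour (Set.mem_univ _)) h0
    have h1 := hb c hc.1 hc.2 z hz
    have hne : (1 - (c : ℂ)) ≠ 0 := by
      rw [sub_ne_zero]; exact_mod_cast hc.2.symm
    rw [norm_div, div_le_iff₀ (norm_pos_iff.2 hne)] at h1
    linarith
  · simp only [preDesZeta_eq hs, desZetaInt_eq_hankel hε.1 hε.2 hs]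
    have hcont := fun k : Fin r => isContour_hankelN hε.1 hε.2 (s k)
    -- The constant `C` does not depend on `c`, so one majorant serves all `c` near 1.
    refine tendsto_integral_filter_of_dominated_convergence _ ?_ ?_ (integrable_majorant C hcont) ?_
    · exact Eventually.of_forall fun c => (measurable_iterIntegrand
        ((measurable_kernel c).div_const _) (fun k => (hcont k).measurable_path)
        (fun k => (hcont k).measurable_weight) 0).aestronglyMeasurable
    · filter_upwards [hc] with c hc
      exact ae_of_all _ fun u => norm_iterIntegrand_le hδ.le (depthRadius_add r) hC.le
        (hb c hc.1 hc.2) (fun k => (hcont k).le_re) (fun k => (hcont k).abs_im_le) h0 u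
    · refine ae_of_all _ fun u => ?_
      unfold iterIntegrand
      refine Tendsto.mul_const _ (tendsto_finsetProd _ fun j _ => tendsto_kernel_div ?_)
      exact halfStrip_subset_strip one_le_two (tail_sum_bounds hδ.le (depthRadius_add r) h0
        (z := fun k => hankel ε (u k)) (fun k => (hcont k).le_re _)
        (fun k => (hcont k).abs_im_le _) j).1

theorem isDesZeta_desZeta (r : ℕ) : IsDesZeta r (desZeta r) := by
  have h : ∃ F, IsDesZeta r F := ⟨_, isDesZeta_desZetaInt r⟩
  rw [desZeta, dif_pos h]
  exact h.choose_spec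

theorem desZeta_eq (r : ℕ) : desZeta r = desZetaInt r :=
  (isDesZeta_desZeta r).unique (isDesZeta_desZetaInt r)

/-! ### Values at nonpositive integers through Cauchy's formula. -/

theorem hankelCoeff_neg_natCast (n : ℕ) :
    hankelCoeff (-n) = (-1) ^ n * n.factorial / (2 * Real.pi * Complex.I) := by
  have h1 : -(Real.pi * Complex.I * -(n : ℂ)) = n * (Real.pi * Complex.I) := by ring
  have h2 : (1 : ℂ) - -(n : ℂ) = n + 1 := by ring
  rw [hankelCoeff, h1, h2, Complex.exp_nat_mul, Complex.exp_pi_mul_I,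
    Complex.Gamma_nat_eq_factorial]

/-- At nonpositive integers the normalized Hankel integral is a derivative at the origin. -/
theorem integral_hankelN_neg_natCast {ε : ℝ} (hε : 0 < ε) {F : ℂ → ℂ} (n : ℕ)
    (hF : DifferentiableOn ℂ F (Metric.closedBall 0 ε))
    (hint : Integrable fun u => F (hankel ε u) * hankelWeight ε (-n) u) :
    ∫ u, F (hankel ε u) * hankelNWeight ε (-n) u = (-1) ^ n * iteratedDeriv n F 0 := by
  have hexp : Complex.exp (2 * Real.pi * Complex.I * -(n : ℂ)) - 1 = 0 := by
    have h := Complex.exp_int_mul_two_pi_mul_I (-n)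
    rw [sub_eq_zero, ← h]
    push_cast
    ring_nf
  -- At exponent `-n` the power is single-valued, and the arc integral is the Cauchy integral of `F
  -- z / z ^ (n + 1)`.
  have hcirc : Complex.I * (∫ θ in (0 : ℝ)..2 * Real.pi,
      logForm F (-n) (Real.log ε + θ * Complex.I)) =
      ∮ z in C(0, ε), (1 / (z - 0) ^ (n + 1)) • F z := by
    rw [circleIntegral, ← intervalIntegral.integral_const_mul]
    refine intervalIntegral.integral_congr fun θ _ => ?_
    have hz : Complex.exp ((Real.log ε : ℂ) + θ * Complex.I) = circleMap 0 ε θ := by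
      rw [circleMap, zero_add, Complex.exp_add, ← Complex.ofReal_exp, Real.exp_log hε]
    have hz0 : circleMap 0 ε θ ≠ 0 := circleMap_ne_center hε.ne'
    have hzn : Complex.exp (-(n : ℂ) * ((Real.log ε : ℂ) + θ * Complex.I)) =
        (circleMap 0 ε θ ^ n)⁻¹ := by
      rw [neg_mul, Complex.exp_neg, Complex.exp_nat_mul, hz]
    simp only [logForm, hz, hzn, deriv_circleMap, smul_eq_mul, sub_zero]
    field_simp
    ring
  have hπ : (Real.pi : ℂ) ≠ 0 := by exact_mod_cast Real.pi_ne_zero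
  have hn : (n.factorial : ℂ) ≠ 0 := by exact_mod_cast n.factorial_ne_zero
  simp only [hankelNWeight, mul_left_comm _ (hankelCoeff _), integral_const_mul]
  rw [integral_hankel hε F _ hint, hexp, zero_mul, add_zero, hcirc,
    hF.circleIntegral_one_div_sub_center_pow_smul hε, hankelCoeff_neg_natCast, smul_eq_mul]
  field_simp

/-- The outermost contour integral becomes a derivative at the base point, which yields the analogue
in `y` of the recursive definition of `desLi`. -/
theorem iterInt_hankel_succ {r : ℕ} {δ ρ : ℝ} (hδ : 0 < δ) (hρ : ρ + (r + 1 : ℕ) * δ ≤ 1)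
    (k : Fin (r + 1) → ℤ) {n : ℕ} (hn : k (Fin.last r) = -n) {y : ℂ} (hy : y ∈ halfStrip ρ) :
    iterInt (r + 1) desKer (fun _ => hankel δ) (fun j => hankelNWeight δ (k j)) y =
      (-1) ^ n * iteratedDeriv n (fun z => desKer z *
        iterInt r desKer (fun _ => hankel δ) (fun j => hankelNWeight δ (Fin.init k j)) z) y := by
  obtain ⟨C, hC, hb⟩ := exists_norm_desKer_le'
  have hc : ∀ s : ℂ, IsContour δ (hankel δ) (hankelNWeight δ s) := isContour_hankelN hδ le_rfl
  have hρ' : (ρ + δ) + r * δ ≤ 1 := by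
    push_cast at hρ; linarith
  have hf := differentiableOn_mul_iterInt hδ.le hρ' hC measurable_desKer
    differentiableOn_desKer_halfStrip hb fun j : Fin r => hc (Fin.init k j : ℤ)
  have hfb := exists_norm_mul_iterInt_le hδ.le hρ' hC hb fun j : Fin r => hc (Fin.init k j : ℤ)
  rw [iterInt_succ (integrable_iterIntegrand hδ.le hρ hC measurable_desKer hb (fun j => hc _) hy)]
  have hlast : ((k (Fin.last r) : ℤ) : ℂ) = -(n : ℂ) := by rw [hn]; push_cast; rfl
  rw [hlast]
  set f : ℂ → ℂ := fun z => desKer z *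
    iterInt r desKer (fun _ => hankel δ) (fun j => hankelNWeight δ (Fin.init k j)) z with hfdef
  refine (integral_hankelN_neg_natCast (F := fun x => f (y + x)) hδ n
    (differentiableOn_translate le_rfl hf hy)
    (((isContourFamily_hankel hδ le_rfl).isContour (Set.mem_univ _)).integrable_mul
      hf.continuousOn hfb hy)).trans ?_
  simp only [iteratedDeriv_comp_const_add, add_zero]

/-! ### The substitution `y = -log t`. -/

theorem neg_log_mem_halfStrip {ρ t : ℝ} (hρ : 0 < ρ) (ht : t ∈ Set.Ioo 0 1) :
    ((-Real.log t : ℝ) : ℂ) ∈ halfStrip ρ := by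
  have := Real.log_neg ht.1 ht.2
  exact ⟨by rw [Complex.ofReal_re]; linarith, by simpa using hρ⟩

/-- Chain rule: `t d/dt` is `-d/dy` in the variable `y = -log t`. -/
theorem opD_eq {ρ : ℝ} (hρ : 0 < ρ) {g : ℝ → ℝ} {Ψ : ℂ → ℂ}
    (hΨ : DifferentiableOn ℂ Ψ (halfStrip ρ))
    (hg : ∀ t ∈ Set.Ioo (0 : ℝ) 1, (g t : ℂ) = Ψ ((-Real.log t : ℝ) : ℂ)) {t : ℝ}
    (ht : t ∈ Set.Ioo (0 : ℝ) 1) :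
    (opD g t : ℂ) = -deriv Ψ ((-Real.log t : ℝ) : ℂ) := by
  have hd : HasDerivAt Ψ (deriv Ψ ((-Real.log t : ℝ) : ℂ)) ((-Real.log t : ℝ) : ℂ) :=
    (hΨ.differentiableAt ((isOpen_halfStrip ρ).mem_nhds (neg_log_mem_halfStrip hρ ht))).hasDerivAt
  have hl : HasDerivAt (fun t : ℝ => ((-Real.log t : ℝ) : ℂ)) ((-t⁻¹ : ℝ) : ℂ) t :=
    (Real.hasDerivAt_log ht.1.ne').neg.ofReal_comp
  have hcomp : HasDerivAt (fun t : ℝ => (g t : ℂ))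
      (deriv Ψ ((-Real.log t : ℝ) : ℂ) * ((-t⁻¹ : ℝ) : ℂ)) t := by
    refine (HasDerivAt.comp (h₂ := Ψ) t hd hl).congr_of_eventuallyEq ?_
    filter_upwards [Ioo_mem_nhds ht.1 ht.2] with x hx using hg x hx
  -- Only the complexification of `g` is known to be differentiable; taking real parts gives
  -- differentiability of `g` itself.
  have hre : HasDerivAt g (deriv Ψ ((-Real.log t : ℝ) : ℂ) * ((-t⁻¹ : ℝ) : ℂ)).re t := by
    simpa using! Complex.reCLM.hasFDerivAt.comp_hasDerivAt t hcomp
  have ht0 : (t : ℂ) ≠ 0 := by exact_mod_cast ht.1.ne'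
  rw [opD, hre.deriv, Complex.ofReal_mul, hre.ofReal_comp.unique hcomp]
  push_cast
  field_simp

theorem differentiableOn_iteratedDeriv {s : Set ℂ} (hs : IsOpen s) {Ψ : ℂ → ℂ}
    (hΨ : DifferentiableOn ℂ Ψ s) (n : ℕ) : DifferentiableOn ℂ (iteratedDeriv n Ψ) s := by
  induction n with
  | zero => simpa using hΨ
  | succ n ih => rw [iteratedDeriv_succ]; exact ih.deriv hs

theorem iterate_opD_eq {ρ : ℝ} (hρ : 0 < ρ) {g : ℝ → ℝ} {Ψ : ℂ → ℂ}
    (hΨ : DifferentiableOn ℂ Ψ (halfStrip ρ))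
    (hg : ∀ t ∈ Set.Ioo (0 : ℝ) 1, (g t : ℂ) = Ψ ((-Real.log t : ℝ) : ℂ)) (n : ℕ) :
    ∀ t ∈ Set.Ioo (0 : ℝ) 1,
      ((opD^[n] g t : ℝ) : ℂ) = (-1) ^ n * iteratedDeriv n Ψ ((-Real.log t : ℝ) : ℂ) := by
  induction n with
  | zero => simpa using hg
  | succ n ih =>
    intro t ht
    have hd := differentiableOn_iteratedDeriv (isOpen_halfStrip ρ) hΨ n
    rw [Function.iterate_succ_apply', opD_eq hρ (hd.const_mul ((-1) ^ n)) ih ht,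
      iteratedDeriv_succ, deriv_const_mul_field]
    ring

theorem opJPow_neg_natCast (n : ℕ) : opJPow (-n) = opD^[n] := by
  cases n with
  | zero => rfl
  | succ n => rfl

theorem desLiZero_eq {t : ℝ} (ht : t ∈ Set.Ioo (0 : ℝ) 1) :
    (desLiZero t : ℂ) = desKer ((-Real.log t : ℝ) : ℂ) := by
  have hz := neg_log_mem_halfStrip one_pos ht
  have hl := Real.log_neg ht.1 ht.2
  have ht0 : (t : ℂ) ≠ 0 := by exact_mod_cast ht.1.ne'
  have ht1 : (1 : ℂ) - t ≠ 0 := by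
    rw [sub_ne_zero]; exact_mod_cast ht.2.ne'
  have hexp : Complex.exp ((-Real.log t : ℝ) : ℂ) = (t : ℂ)⁻¹ := by
    rw [← Complex.ofReal_exp, Real.exp_neg, Real.exp_log ht.1, Complex.ofReal_inv]
  rw [desKer_of_ne (halfStrip_subset_strip one_le_two hz) (by exact_mod_cast (neg_pos.2 hl).ne'),
    hexp, desLiZero]
  have h1 : (t : ℂ)⁻¹ - 1 = (1 - t) / t := by field_simp
  rw [h1]
  push_cast
  field_simp
  ring

/-- Both sides obey the same recursion: multiply by `L₀(t) = desKer y`, then apply `(t d/dt) ^ n =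
(-d/dy) ^ n`. The half-strip grows by `δ` with each step inwards. -/
theorem desLi_eq {δ : ℝ} (hδ : 0 < δ) (r : ℕ) {ρ : ℝ} (hρ0 : 0 < ρ) (hρ : ρ + r * δ ≤ 1)
    (k : Fin r → ℤ) (hk : ∀ j, k j ≤ 0) :
    ∀ t ∈ Set.Ioo (0 : ℝ) 1, (desLi r k t : ℂ) =
      iterInt r desKer (fun _ => hankel δ) (fun j => hankelNWeight δ (k j))
        ((-Real.log t : ℝ) : ℂ) := by
  induction r generalizing ρ with
  | zero => intro t _; simp [desLi, iterInt_zero]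
  | succ r ih =>
    intro t ht
    obtain ⟨C, hC, hb⟩ := exists_norm_desKer_le'
    obtain ⟨n, hn⟩ := Int.eq_ofNat_of_zero_le (neg_nonneg.2 (hk (Fin.last r)))
    have hn' : k (Fin.last r) = -n := by omega
    have hρ' : (ρ + δ) + r * δ ≤ 1 := by
      push_cast at hρ; linarith
    have hf := differentiableOn_mul_iterInt hδ.le hρ' hC measurable_desKer
      differentiableOn_desKer_halfStrip hb
      fun j : Fin r => isContour_hankelN hδ le_rfl (Fin.init k j : ℤ)
    rw [iterInt_hankel_succ hδ hρ k hn' (neg_log_mem_halfStrip hρ0 ht), desLi, hn',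
      opJPow_neg_natCast]
    refine iterate_opD_eq (by linarith) hf (fun x hx => ?_) n t ht
    rw [Complex.ofReal_mul, desLiZero_eq hx,
      ih (by linarith) hρ' (Fin.init k) (fun j => hk j.castSucc) x hx]

theorem desZetaInt_eq_of_nonpos {r : ℕ} {k : Fin r → ℤ} (hk : ∀ j, k j ≤ 0) :
    desZetaInt r (fun j => (k j : ℂ)) = iterInt r desKer (fun _ => hankel (depthRadius r))
      (fun j => hankelNWeight (depthRadius r) (k j)) 0 := by
  have h : ∀ j, mixChoice (k j : ℂ) = false := fun j => by
    have : (k j : ℝ) ≤ 0 := by exact_mod_cast hk j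
    have h2 : ¬ 1 / 2 < (k j : ℝ) := by linarith
    simp only [mixChoice, Complex.intCast_re, h2, decide_false]
  simp only [desZetaInt, h, mixPath, mixWeight, Bool.false_eq_true, if_false]

/-- The point `y = 0` is interior to the half-strip where `iterInt` is holomorphic, so the limit
exists by continuity and is the value there. -/
theorem tendsto_desLi {r : ℕ} {k : Fin r → ℤ} (hk : ∀ j, k j ≤ 0) :
    Tendsto (fun t : ℝ => (desLi r k t : ℂ)) (𝓝[<] 1) (𝓝 (desZetaInt r fun j => (k j : ℂ))) := by
  obtain ⟨C, hC, hb⟩ := exists_norm_desKer_le'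
  have hδ := depthRadius_pos r
  have hd := differentiableOn_iterInt hδ.le (depthRadius_add r) hC measurable_desKer
    differentiableOn_desKer_halfStrip hb fun j : Fin r => isContour_hankelN hδ le_rfl (k j)
  have hcont := hd.continuousOn.continuousAt
    ((isOpen_halfStrip _).mem_nhds (zero_mem_halfStrip hδ))
  have hlog : Tendsto (fun t : ℝ => ((-Real.log t : ℝ) : ℂ)) (𝓝[<] 1) (𝓝 0) := by
    have h : ContinuousAt (fun t : ℝ => ((-Real.log t : ℝ) : ℂ)) 1 :=
      Complex.continuous_ofReal.continuousAt.comp (Real.continuousAt_log one_ne_zero).neg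
    have h' := h.tendsto
    simp only [Real.log_one, neg_zero, Complex.ofReal_zero] at h'
    exact h'.mono_left nhdsWithin_le_nhds
  rw [desZetaInt_eq_of_nonpos hk]
  refine (hcont.tendsto.comp hlog).congr' ?_
  filter_upwards [Ioo_mem_nhdsLT one_pos] with t ht
  exact (desLi_eq hδ r hδ (depthRadius_add r) k hk t ht).symm

end DesMZF

end

theorem mainTheorem10 (r : ℕ) (hr : 1 ≤ r) :
    DesMZF.IsDesZeta r (DesMZF.desZeta r) ∧
      ∀ k : Fin r → ℤ, (∀ j, k j ≤ 0) →
        Tendsto (fun t : ℝ => (DesMZF.desLi r k t : ℂ)) (𝓝[<] 1)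
          (𝓝 (DesMZF.desZeta r (fun j => (k j : ℂ)))) := by
  refine ⟨DesMZF.isDesZeta_desZeta r, fun k hk => ?_⟩
  rw [DesMZF.desZeta_eq]
  exact DesMZF.tendsto_desLi hk
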